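/- Let $d\ge 1$ and $0<p<1$. For $n\ge 1$ let $\Lambda_n=[1,n]^d\cap\mathbb Z^d$, $x_*=(1,\dots,1)$, $\Omega_n=\{0,1\}^{\Lambda_n}$, and let $\pi=\pi_n$ be the product Bernoulli$(p)$ measure on $\Omega_n$ (each spin is $1$ with probability $p$). For each $n\ge1$ let $\{\mathcal C_x\}_{x\in\Lambda_n}=\{\mathcal C^{(n)}_x\}_{x\in\Lambda_n}$ be constraining neighbourhoods: $\mathcal C_{x_*}=\emptyset$ and, for $x\ne x_*$, $$\emptyset\ne\mathcal C_x\subset\Lambda_n\cap\Big\{x-\sum_{i=1}^d\alpha_i\mathbf e_i:\ \alpha_i\in\{0,1\}\Big\}\setminus\{x\}.$$ Put $c_x(\sigma)=\prod_{y\in\mathcal C_x}(1-\sigma_y)$ (so $c_{x_*}\equiv1$) and consider the continuous-time Markov chain on $\Omega_n$ with generator $$\mathcal L_nf(\sigma)=\sum_{x\in\Lambda_n}c_x(\sigma)\,[\pi_x(f)(\sigma)-f(\sigma)],$$ where $\pi_x(f)$ is the conditional $\pi$-mean of $f$ given $\{\sigma_y\}_{y\ne x}$. Let $\nu_t$ be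 its law at time $t$ when the initial law is $\nu$, and define $$\lambda^{(n)}=\inf_{f\ne\mathrm{const}}\frac{-\pi(f\mathcal L_nf)}{\mathrm{Var}_\pi(f)},\qquad T^{(n)}_{\rm mix}=\inf\Big\{t>0:\ \sup_{\nu}\|\nu_t-\pi\|_{\rm TV}\le \tfrac14\Big\},$$ where the infimum in $\lambda^{(n)}$ is over $f:\Omega_n\to\mathbb R$ and the supremum is over all probability measures $\nu$ on $\Omega_n$. If $\inf_{n\ge1}\lambda^{(n)}>0$, then there are constants $C,C'>0$ independent of $n$ such that $$C\,n\le T^{(n)}_{\rm mix}\ \text{ for all } n\ge1,\qquad T^{(n)}_{\rm mix}\le C'\,n\log n\ \text{ for all } n\ge2.$$ -/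

import Mathlib

noncomputable section

namespace OrientedKCM

/-- The cube `[1,n]^d ∩ ℤ^d`, which has `n ^ d` sites. -/
abbrev cube (d n : ℕ) : Finset (Fin d → ℤ) :=
  Fintype.piFinset fun _ => Finset.Icc (1 : ℤ) (n : ℤ)

/-- The type of sites of the cube. -/
abbrev Site (d n : ℕ) : Type := {x : Fin d → ℤ // x ∈ cube d n}

/-- Configurations: assignments of a spin `0` or `1` to every site. -/
abbrev Config (d n : ℕ) : Type := Site d n → Fin 2

/-- The oriented neighbourhood of `x` in `ℤ^d`:
all points `x - ∑ i, α i • e i` with `α i ∈ {0,1}`, except `x` itself. -/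
def swNeighbourhood {d : ℕ} (x : Fin d → ℤ) : Set (Fin d → ℤ) :=
  {y | ∃ α : Fin d → ℤ, (∀ i, α i = 0 ∨ α i = 1) ∧
    y = x - ∑ i, α i • (Pi.single i 1 : Fin d → ℤ)} \ {x}

/-- `C` is a collection of constraining neighbourhoods on the cube: the neighbourhood of the
south-west corner `(1,…,1)` is empty, that of any other site is a nonempty set of sites of the
cube contained in the oriented neighbourhood of that site. -/
def IsConstraining {d n : ℕ} (C : Site d n → Finset (Site d n)) : Prop :=
  ∀ x : Site d n,
    (x.1 = 1 → C x = ∅) ∧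
    (x.1 ≠ 1 → (C x).Nonempty ∧ ∀ y ∈ C x, y.1 ∈ swNeighbourhood x.1)

section Dynamics

variable {d n : ℕ} (p : ℝ) (C : Site d n → Finset (Site d n))

/-- The constraint `c_x(σ) = ∏_{y ∈ C_x} (1 - σ_y)`; it is `1` if `C_x` is empty. -/
def constraint (x : Site d n) (σ : Config d n) : ℝ :=
  ∏ y ∈ C x, (1 - ((σ y : ℕ) : ℝ))

/-- The one-site Bernoulli(`p`) weights. -/
def bernoulli (s : Fin 2) : ℝ := if s = 1 then p else 1 - p

/-- The product Bernoulli(`p`) measure, as a probability vector. -/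
def productMeasure (σ : Config d n) : ℝ := ∏ x, bernoulli p (σ x)

/-- The mean of `f` under the product measure. -/
def mean (f : Config d n → ℝ) : ℝ := ∑ σ, productMeasure p σ * f σ

/-- The variance of `f` under the product measure. -/
def var (f : Config d n → ℝ) : ℝ := mean p (fun σ => (f σ - mean p f) ^ 2)

/-- The conditional mean of `f` given the spins outside `x`. -/
def condMean (x : Site d n) (f : Config d n → ℝ) (σ : Config d n) : ℝ :=
  ∑ s : Fin 2, bernoulli p s * f (Function.update σ x s)

/-- The generator `(L f)(σ) = ∑ x, c_x(σ) (π_x(f)(σ) - f(σ))`, as a linear operator. -/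
def generatorLin : (Config d n → ℝ) →ₗ[ℝ] (Config d n → ℝ) where
  toFun f σ := ∑ x, constraint C x σ * (condMean p x f σ - f σ)
  map_add' f g := by
    funext σ
    simp only [condMean, Pi.add_apply, ← Finset.sum_add_distrib, mul_add]
    refine Finset.sum_congr rfl fun x _ => ?_
    rw [Finset.sum_add_distrib]
    ring
  map_smul' a f := by
    funext σ
    simp only [condMean, Pi.smul_apply, smul_eq_mul, RingHom.id_apply, Finset.mul_sum]
    refine Finset.sum_congr rfl fun x _ => ?_
    have h : ∑ s : Fin 2, bernoulli p s * (a * f (Function.update σ x s))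
        = a * ∑ s : Fin 2, bernoulli p s * f (Function.update σ x s) := by
      rw [Finset.mul_sum]
      exact Finset.sum_congr rfl fun s _ => by ring
    rw [h]
    ring

/-- The generator as a bounded operator on the finite-dimensional space of functions. -/
def generator : (Config d n → ℝ) →L[ℝ] (Config d n → ℝ) :=
  LinearMap.toContinuousLinearMap (generatorLin p C)

/-- The Markov semigroup `P_t = exp (t L)` of the continuous-time chain. -/
def semigroup (t : ℝ) : (Config d n → ℝ) →L[ℝ] (Config d n → ℝ) :=
  NormedSpace.exp (t • generator p C)

/-- The law at time `t` of the chain with initial law `ν`: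
`ν_t(η) = ∑ σ, ν(σ) P_t(σ, η)`. -/
def lawAt (ν : Config d n → ℝ) (t : ℝ) (η : Config d n) : ℝ :=
  ∑ σ, ν σ * semigroup p C t (Pi.single η 1) σ

/-- The total variation distance. -/
def tvDist (μ ν : Config d n → ℝ) : ℝ := (1 / 2) * ∑ σ, |μ σ - ν σ|

/-- The Dirichlet form `-π(f L f)`. -/
def dirichletForm (f : Config d n → ℝ) : ℝ :=
  -mean p (fun σ => f σ * generator p C f σ)

/-- The spectral gap: the infimum of `D(f) / Var(f)` over nonconstant `f`. -/
def spectralGap : ℝ :=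
  ⨅ f : {f : Config d n → ℝ // ¬ ∃ a : ℝ, ∀ σ, f σ = a},
    dirichletForm p C f.1 / var p f.1

/-- The mixing time: the infimum of the times `t > 0` at which the total variation distance to
equilibrium is at most `1/4` for all initial laws `ν`. -/
def mixingTime : ℝ :=
  sInf {t : ℝ | 0 < t ∧ ∀ ν ∈ stdSimplex ℝ (Config d n),
    tvDist (lawAt p C ν t) (productMeasure p) ≤ 1 / 4}

end Dynamics

end OrientedKCM

end

/-! Upper bound. The constraint at a site reads only sites of smaller coordinate sum (`siteRank`),
so a set of sites closed under the neighbourhoods evolves autonomously. Let `S` be such a set and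
let `C x ⊆ S` with `x ∉ S`. A legal update of `x` resamples its spin, so once one has occurred the
spin at `x` is Bernoulli and independent of `S`; the error is the probability `survival` that none
has occurred (`semigroup_le_survival_add`). If `S` is already close to equilibrium, this probability
may be computed in equilibrium, where the spectral gap makes it decay exponentially at a rate not
depending on `n` (`mean_survival_le`). Treating one layer of constant rank per time interval of
length `s` (`mixedOn_layers`) gives distance at most `n ^ d * exp (-μ s)` after `d n + 1` intervals,
and `s` of order `log n` suffices.

Lower bound. Start from all ones. A zero at a site can only be created when its whole neighbourhood
is zero, so zeros reach `(n,…,n)` along a chain of about `n` sites, each in the neighbourhood of the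
one before. An exponentially weighted count of zeros along the chain grows in mean by a factor of at
most `exp (2 t)` (`generator_chainWeight_le`). Hence for small `t / n` the first few chain sites are
still all `1` with high probability, which is unlikely under equilibrium (`le_exp_of_tvDist_le`). -/

noncomputable section

namespace OrientedKCM

/-! ### Exponentials of bounded operators: invariance, positivity, growth. -/

section Exponential

variable {E : Type*} [NormedAddCommGroup E] [NormedSpace ℝ E] [CompleteSpace E]

theorem hasSum_exp_apply (A : E →L[ℝ] E) (v : E) :
    HasSum (fun k : ℕ => ((k.factorial : ℝ)⁻¹) • (A ^ k) v) (NormedSpace.exp A v) := by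
  have h := NormedSpace.exp_series_hasSum_exp' (𝕂 := ℝ) A
  simpa using h.mapL (ContinuousLinearMap.apply ℝ E v)

theorem exp_apply_mem {A : E →L[ℝ] E} {S : Submodule ℝ E} (hS : IsClosed (S : Set E))
    (hA : ∀ v ∈ S, A v ∈ S) {v : E} (hv : v ∈ S) : NormedSpace.exp A v ∈ S := by
  have hpow : ∀ k : ℕ, (A ^ k) v ∈ S := by
    intro k
    induction k with
    | zero => simpa using hv
    | succ k ih => rw [pow_succ']; exact hA _ ih
  exact hS.mem_of_tendsto (hasSum_exp_apply A v)
    (Filter.Eventually.of_forall fun s => S.sum_mem fun k _ => S.smul_mem _ (hpow k))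

theorem exp_apply_eq_of_eqOn {A B : E →L[ℝ] E} {S : Set E} (hB : ∀ v ∈ S, B v ∈ S)
    (hAB : ∀ v ∈ S, A v = B v) {v : E} (hv : v ∈ S) :
    NormedSpace.exp A v = NormedSpace.exp B v := by
  have hpow : ∀ k : ℕ, (A ^ k) v = (B ^ k) v ∧ (B ^ k) v ∈ S := by
    intro k
    induction k with
    | zero => simpa using hv
    | succ k ih =>
      rw [pow_succ', pow_succ']
      refine ⟨?_, hB _ ih.2⟩
      rw [mul_apply_eq_comp, mul_apply_eq_comp, ih.1, hAB _ ih.2]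
  have h := hasSum_exp_apply A v
  simp only [fun k => (hpow k).1] at h
  exact h.unique (hasSum_exp_apply B v)

theorem comp_exp_eq_of_comp_eq_zero {F : Type*} [NormedAddCommGroup F] [NormedSpace ℝ F]
    {A : E →L[ℝ] E} {T : E →L[ℝ] F} (h : ∀ v, T (A v) = 0) (v : E) :
    T (NormedSpace.exp A v) = T v := by
  have hs := (hasSum_exp_apply A v).mapL T
  refine hs.unique ?_
  have h0 := hasSum_single (f := fun k : ℕ => T (((k.factorial : ℝ)⁻¹) • (A ^ k) v)) 0
    (fun k hk => by
      obtain ⟨j, rfl⟩ := Nat.exists_eq_succ_of_ne_zero hk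
      rw [map_smul, pow_succ', mul_apply_eq_comp, h, smul_zero])
  simpa using h0

theorem exp_add_of_commute_real {A B : E →L[ℝ] E} (h : Commute A B) :
    NormedSpace.exp (A + B) = NormedSpace.exp A * NormedSpace.exp B :=
  letI : NormedAlgebra ℚ (E →L[ℝ] E) := NormedAlgebra.restrictScalars ℚ ℝ _
  NormedSpace.exp_add_of_commute h

end Exponential

/-- `A + K` preserves positivity, hence so does its exponential series, and `exp A = exp (-K) • exp
(A + K)`. -/
theorem exp_apply_nonneg {α : Type*} [Fintype α] {A : (α → ℝ) →L[ℝ] (α → ℝ)} {K : ℝ}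
    (hA : ∀ f : α → ℝ, 0 ≤ f → 0 ≤ A f + K • f) {f : α → ℝ} (hf : 0 ≤ f) :
    0 ≤ NormedSpace.exp A f := by
  set B : (α → ℝ) →L[ℝ] (α → ℝ) := A + K • 1 with hBdef
  have hB : ∀ k : ℕ, 0 ≤ (B ^ k) f := by
    intro k
    induction k with
    | zero => simpa using hf
    | succ k ih =>
      rw [pow_succ']
      simpa [hBdef] using hA _ ih
  have hBexp : 0 ≤ NormedSpace.exp B f :=
    (hasSum_exp_apply B f).nonneg fun k => smul_nonneg (by positivity) (hB k)
  have hcomm : Commute ((-K) • (1 : (α → ℝ) →L[ℝ] (α → ℝ))) B :=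
    (Commute.one_left B).smul_left (-K)
  have hexp : NormedSpace.exp A = Real.exp (-K) • NormedSpace.exp B := by
    have h1 : A = (-K) • 1 + B := by rw [hBdef]; module
    have h2 : NormedSpace.exp ((-K) • (1 : (α → ℝ) →L[ℝ] (α → ℝ))) = Real.exp (-K) • 1 := by
      have h := NormedSpace.algebraMap_exp_comm (𝕂 := ℝ) (𝔸 := (α → ℝ) →L[ℝ] (α → ℝ)) (-K)
      rw [Algebra.algebraMap_eq_smul_one, Algebra.algebraMap_eq_smul_one] at h
      rw [← h, Real.exp_eq_exp_ℝ]
    rw [h1, exp_add_of_commute_real hcomm, h2, smul_mul_assoc, one_mul]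
  rw [hexp]
  exact smul_nonneg (Real.exp_pos _).le hBexp

theorem hasDerivAt_exp_smul_apply {α : Type*} [Fintype α] (A : (α → ℝ) →L[ℝ] (α → ℝ))
    (f : α → ℝ) (t : ℝ) :
    HasDerivAt (fun s : ℝ => NormedSpace.exp (s • A) f) (A (NormedSpace.exp (t • A) f)) t :=
  ((ContinuousLinearMap.apply ℝ (α → ℝ) f).hasFDerivAt.comp_hasDerivAt t
    (hasDerivAt_exp_smul_const' (𝕂 := ℝ) A t))

theorem hasDerivAt_exp_smul_apply_coord {α : Type*} [Fintype α] (A : (α → ℝ) →L[ℝ] (α → ℝ))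
    (f : α → ℝ) (a : α) (t : ℝ) :
    HasDerivAt (fun s : ℝ => NormedSpace.exp (s • A) f a) (NormedSpace.exp (t • A) (A f) a) t := by
  have h := ((ContinuousLinearMap.apply ℝ (α → ℝ) f).hasFDerivAt.comp_hasDerivAt t
    (hasDerivAt_exp_smul_const (𝕂 := ℝ) A t))
  exact (hasDerivAt_pi.1 h) a

/-- The derivative of `exp (-κ s) • exp (s A) f` is `exp (-κ s) • exp (s A) (A f - κ f)`, which is
nonpositive by positivity of the semigroup. -/
theorem exp_smul_apply_le {α : Type*} [Fintype α] {A : (α → ℝ) →L[ℝ] (α → ℝ)}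
    (hpos : ∀ t : ℝ, 0 ≤ t → ∀ f : α → ℝ, 0 ≤ f → 0 ≤ NormedSpace.exp (t • A) f)
    {f : α → ℝ} {κ : ℝ} (hf : A f ≤ κ • f) {t : ℝ} (ht : 0 ≤ t) :
    NormedSpace.exp (t • A) f ≤ Real.exp (κ * t) • f := by
  intro a
  have hder : ∀ s : ℝ, HasDerivAt (fun s : ℝ => Real.exp (-κ * s) * NormedSpace.exp (s • A) f a)
      (Real.exp (-κ * s) * NormedSpace.exp (s • A) (A f - κ • f) a) s := by
    intro s
    have h1 : HasDerivAt (fun s : ℝ => Real.exp (-κ * s)) (Real.exp (-κ * s) * (-κ)) s := by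
      simpa using ((hasDerivAt_id s).const_mul (-κ)).exp
    refine (h1.mul (hasDerivAt_exp_smul_apply_coord A f a s)).congr_deriv ?_
    simp only [map_sub, map_smul, Pi.sub_apply, Pi.smul_apply, smul_eq_mul]
    ring
  have hanti : AntitoneOn (fun s : ℝ => Real.exp (-κ * s) * NormedSpace.exp (s • A) f a)
      (Set.Ici 0) := by
    refine antitoneOn_of_deriv_nonpos (convex_Ici 0)
      (fun s _ => (hder s).continuousAt.continuousWithinAt)
      (fun s _ => (hder s).differentiableAt.differentiableWithinAt) fun s hs => ?_
    rw [interior_Ici] at hs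
    rw [(hder s).deriv]
    refine mul_nonpos_of_nonneg_of_nonpos (Real.exp_pos _).le ?_
    have h := hpos s hs.le (κ • f - A f) (sub_nonneg.2 hf) a
    rw [← neg_sub, map_neg, Pi.neg_apply]
    simpa using h
  have h := hanti (Set.mem_Ici.2 le_rfl) (Set.mem_Ici.2 ht) ht
  have h2 : Real.exp (-κ * t) * NormedSpace.exp (t • A) f a ≤ f a := by simpa using h
  have h3 := mul_le_mul_of_nonneg_left h2 (Real.exp_pos (κ * t)).le
  rwa [← mul_assoc, ← Real.exp_add, neg_mul, add_neg_cancel, Real.exp_zero, one_mul] at h3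

/-! ### The product measure and single-site conditional means. -/

section ProductMeasure

variable {d n : ℕ} {p : ℝ}

theorem sum_bernoulli (p : ℝ) : ∑ s : Fin 2, bernoulli p s = 1 := by
  simp [Fin.sum_univ_two, bernoulli]

theorem bernoulli_nonneg (hp0 : 0 < p) (hp1 : p < 1) (s : Fin 2) : 0 ≤ bernoulli p s := by
  unfold bernoulli
  split_ifs <;> linarith

theorem productMeasure_nonneg (hp0 : 0 < p) (hp1 : p < 1) (σ : Config d n) :
    0 ≤ productMeasure p σ :=
  Finset.prod_nonneg fun _ _ => bernoulli_nonneg hp0 hp1 _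

theorem mean_prod (g : Site d n → Fin 2 → ℝ) :
    mean p (fun σ => ∏ x, g x (σ x)) = ∏ x, ∑ s, bernoulli p s * g x s := by
  simp only [mean, productMeasure, ← Finset.prod_mul_distrib]
  rw [Finset.prod_univ_sum, Fintype.piFinset_univ]

theorem sum_productMeasure (p : ℝ) : ∑ σ : Config d n, productMeasure p σ = 1 := by
  have h := mean_prod (p := p) (fun (_ : Site d n) (_ : Fin 2) => (1 : ℝ))
  simp only [mul_one, sum_bernoulli, Finset.prod_const_one] at h
  simpa [mean] using h

theorem mean_const (a : ℝ) : mean p (fun _ : Config d n => a) = a := by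
  rw [mean, ← Finset.sum_mul, sum_productMeasure, one_mul]

theorem mean_add (f g : Config d n → ℝ) : mean p (f + g) = mean p f + mean p g := by
  simp [mean, mul_add, Finset.sum_add_distrib]

theorem mean_sub (f g : Config d n → ℝ) : mean p (f - g) = mean p f - mean p g := by
  simp [mean, mul_sub, Finset.sum_sub_distrib]

theorem mean_smul (a : ℝ) (f : Config d n → ℝ) : mean p (a • f) = a * mean p f := by
  simp only [mean, Pi.smul_apply, smul_eq_mul, Finset.mul_sum]
  exact Finset.sum_congr rfl fun _ _ => by ring

theorem mean_sum {ι : Type*} (A : Finset ι) (f : ι → Config d n → ℝ) :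
    mean p (∑ i ∈ A, f i) = ∑ i ∈ A, mean p (f i) := by
  simp only [mean, Finset.sum_apply, Finset.mul_sum]
  exact Finset.sum_comm

theorem mean_mono (hp0 : 0 < p) (hp1 : p < 1) {f g : Config d n → ℝ} (h : f ≤ g) :
    mean p f ≤ mean p g :=
  Finset.sum_le_sum fun σ _ => mul_le_mul_of_nonneg_left (h σ) (productMeasure_nonneg hp0 hp1 σ)

/-- The mean as a continuous linear functional. -/
def meanCLM (p : ℝ) : (Config d n → ℝ) →L[ℝ] ℝ :=
  LinearMap.toContinuousLinearMap
    { toFun := mean p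
      map_add' := mean_add
      map_smul' := mean_smul }

theorem meanCLM_apply (f : Config d n → ℝ) : meanCLM p f = mean p f := rfl

theorem productMeasure_update_mul (σ : Config d n) (x : Site d n) (s : Fin 2) :
    productMeasure p (Function.update σ x s) * bernoulli p (σ x)
      = productMeasure p σ * bernoulli p s := by
  simp only [productMeasure]
  rw [← Finset.mul_prod_erase _ _ (Finset.mem_univ x),
    ← Finset.mul_prod_erase _ (fun y => bernoulli p (σ y)) (Finset.mem_univ x)]
  have h : ∏ y ∈ Finset.univ.erase x, bernoulli p (Function.update σ x s y)
      = ∏ y ∈ Finset.univ.erase x, bernoulli p (σ y) :=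
    Finset.prod_congr rfl fun y hy => by rw [Function.update_of_ne (Finset.ne_of_mem_erase hy)]
  rw [h, Function.update_self]
  ring

/-- Exchanging the spin at `x` with an auxiliary spin. -/
def swapSpin (x : Site d n) : Config d n × Fin 2 ≃ Config d n × Fin 2 where
  toFun q := (Function.update q.1 x q.2, q.1 x)
  invFun q := (Function.update q.1 x q.2, q.1 x)
  left_inv q := by simp
  right_inv q := by simp

/-- Resampling `x` amounts to swapping its spin with an independent Bernoulli spin, and the swap
preserves the joint measure. -/
theorem mean_condMean (x : Site d n) (f : Config d n → ℝ) :
    mean p (condMean p x f) = mean p f := by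
  have h1 : mean p (condMean p x f) = ∑ q : Config d n × Fin 2,
      productMeasure p q.1 * bernoulli p q.2 * f (Function.update q.1 x q.2) := by
    rw [Fintype.sum_prod_type]
    simp only [mean, condMean, Finset.mul_sum, mul_assoc]
  have h2 : mean p f = ∑ q : Config d n × Fin 2,
      productMeasure p q.1 * bernoulli p q.2 * f q.1 := by
    rw [Fintype.sum_prod_type]
    refine Finset.sum_congr rfl fun σ _ => ?_
    simp only [mul_right_comm _ (bernoulli p _) (f σ)]
    rw [← Finset.mul_sum, sum_bernoulli, mul_one]
  rw [h1, h2, ← Equiv.sum_comp (swapSpin x)]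
  refine Finset.sum_congr rfl fun q _ => ?_
  simp only [swapSpin, Equiv.coe_fn_mk, Function.update_idem, Function.update_eq_self]
  rw [productMeasure_update_mul]

theorem condMean_mono (hp0 : 0 < p) (hp1 : p < 1) (x : Site d n) {f g : Config d n → ℝ}
    (h : f ≤ g) : condMean p x f ≤ condMean p x g := fun _ =>
  Finset.sum_le_sum fun s _ => mul_le_mul_of_nonneg_left (h _) (bernoulli_nonneg hp0 hp1 s)

theorem condMean_const (x : Site d n) (a : ℝ) : condMean p x (fun _ => a) = fun _ => a := by
  funext σ
  rw [condMean, ← Finset.sum_mul, sum_bernoulli, one_mul]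

theorem condMean_zero (x : Site d n) : condMean p x 0 = 0 := condMean_const x 0

theorem condMean_sub (x : Site d n) (f g : Config d n → ℝ) :
    condMean p x (f - g) = condMean p x f - condMean p x g := by
  funext σ
  simp [condMean, mul_sub]

theorem condMean_sum {ι : Type*} (A : Finset ι) (x : Site d n) (f : ι → Config d n → ℝ) :
    condMean p x (∑ i ∈ A, f i) = ∑ i ∈ A, condMean p x (f i) := by
  funext σ
  simp only [condMean, Finset.sum_apply, Finset.mul_sum]
  exact Finset.sum_comm

theorem condMean_comm (x y : Site d n) (f : Config d n → ℝ) :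
    condMean p x (condMean p y f) = condMean p y (condMean p x f) := by
  rcases eq_or_ne x y with rfl | hxy
  · rfl
  funext σ
  simp only [condMean, Finset.mul_sum]
  rw [Finset.sum_comm]
  refine Finset.sum_congr rfl fun s _ => Finset.sum_congr rfl fun s' _ => ?_
  rw [Function.update_comm hxy]
  ring

theorem dependsOn_condMean {S : Set (Site d n)} {f : Config d n → ℝ} (hf : DependsOn f S)
    (x : Site d n) : DependsOn (condMean p x f) (S \ {x}) := by
  intro σ τ h
  refine Finset.sum_congr rfl fun s _ => ?_
  congr 1
  refine hf fun i hi => ?_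
  rcases eq_or_ne i x with rfl | hix
  · simp
  · rw [Function.update_of_ne hix, Function.update_of_ne hix, h i ⟨hi, hix⟩]

theorem condMean_mul_of_dependsOn {S : Set (Site d n)} {c : Config d n → ℝ} (hc : DependsOn c S)
    {x : Site d n} (hx : x ∉ S) (f : Config d n → ℝ) :
    condMean p x (c * f) = c * condMean p x f := by
  funext σ
  simp only [condMean, Pi.mul_apply, Finset.mul_sum]
  refine Finset.sum_congr rfl fun s _ => ?_
  have h : c (Function.update σ x s) = c σ := hc fun i hi => by
    rw [Function.update_of_ne]
    rintro rfl
    exact hx hi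
  rw [h]
  ring

theorem condMean_of_dependsOn {S : Set (Site d n)} {f : Config d n → ℝ} (hf : DependsOn f S)
    {x : Site d n} (hx : x ∉ S) : condMean p x f = f := by
  have h := condMean_mul_of_dependsOn (p := p) hf hx (fun _ => 1)
  rw [condMean_const] at h
  have e : f * (fun _ : Config d n => (1 : ℝ)) = f := mul_one f
  rwa [e] at h

theorem condMean_condMean (x : Site d n) (f : Config d n → ℝ) :
    condMean p x (condMean p x f) = condMean p x f :=
  condMean_of_dependsOn (dependsOn_condMean (dependsOn_univ f) x) (by simp)

end ProductMeasure

/-! ### The generator with killing, its semigroup, stationarity and autonomy. -/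

section Generator

variable {d n : ℕ} {p : ℝ} {C : Site d n → Finset (Site d n)}

theorem spin_compl_mem_Icc (s : Fin 2) : 1 - ((s : ℕ) : ℝ) ∈ Set.Icc (0 : ℝ) 1 := by
  fin_cases s <;> simp

theorem constraint_nonneg (x : Site d n) (σ : Config d n) : 0 ≤ constraint C x σ :=
  Finset.prod_nonneg fun y _ => (spin_compl_mem_Icc (σ y)).1

theorem constraint_le_one (x : Site d n) (σ : Config d n) : constraint C x σ ≤ 1 :=
  Finset.prod_le_one (fun y _ => (spin_compl_mem_Icc (σ y)).1)
    fun y _ => (spin_compl_mem_Icc (σ y)).2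

theorem constraint_le_of_mem {x y : Site d n} (hy : y ∈ C x) (σ : Config d n) :
    constraint C x σ ≤ 1 - ((σ y : ℕ) : ℝ) := by
  rw [constraint, ← Finset.mul_prod_erase _ _ hy]
  exact mul_le_of_le_one_right (spin_compl_mem_Icc (σ y)).1
    (Finset.prod_le_one (fun y _ => (spin_compl_mem_Icc (σ y)).1)
      fun y _ => (spin_compl_mem_Icc (σ y)).2)

theorem dependsOn_constraint (x : Site d n) : DependsOn (constraint C x) (C x : Set (Site d n)) :=
  fun σ τ h => Finset.prod_congr rfl fun y hy => by rw [h y hy]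

theorem mean_constraint (x : Site d n) : mean p (constraint C x) = (1 - p) ^ (C x).card := by
  let g : Site d n → Fin 2 → ℝ := fun y s => if y ∈ C x then 1 - ((s : ℕ) : ℝ) else 1
  have h : constraint C x = fun σ : Config d n => ∏ y, g y (σ y) := by
    funext σ
    simp only [g]
    rw [Finset.prod_ite_mem, Finset.univ_inter]
    rfl
  rw [h, mean_prod]
  have h2 : ∀ y : Site d n,
      ∑ s : Fin 2, bernoulli p s * g y s = if y ∈ C x then 1 - p else 1 := by
    intro y
    simp only [g]
    split_ifs
    · simp [Fin.sum_univ_two, bernoulli]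
    · simpa using sum_bernoulli p
  rw [Finset.prod_congr rfl fun y _ => h2 y, Finset.prod_ite_mem, Finset.univ_inter,
    Finset.prod_const]

/-- The generator whose updates at `x` are killed with probability `1 - w x`. -/
def killedGenerator (p : ℝ) (C : Site d n → Finset (Site d n)) (w : Site d n → ℝ) :
    (Config d n → ℝ) →L[ℝ] (Config d n → ℝ) :=
  LinearMap.toContinuousLinearMap
    { toFun := fun f => ∑ x, constraint C x * (w x • condMean p x f - f)
      map_add' := fun f g => by
        funext σ
        simp only [condMean, Pi.add_apply, Finset.sum_apply, Pi.mul_apply, Pi.sub_apply,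
          Pi.smul_apply, smul_eq_mul, ← Finset.sum_add_distrib, mul_add]
        refine Finset.sum_congr rfl fun x _ => ?_
        rw [Finset.sum_add_distrib]
        ring
      map_smul' := fun a f => by
        funext σ
        simp only [condMean, Pi.smul_apply, Finset.sum_apply, Pi.mul_apply, Pi.sub_apply,
          smul_eq_mul, RingHom.id_apply, Finset.mul_sum]
        refine Finset.sum_congr rfl fun x _ => ?_
        rw [mul_sub, mul_sub, mul_sub, Finset.mul_sum, Finset.mul_sum, Finset.mul_sum]
        congr 1
        · exact Finset.sum_congr rfl fun s _ => by ring
        · ring }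

theorem killedGenerator_apply (w : Site d n → ℝ) (f : Config d n → ℝ) :
    killedGenerator p C w f = ∑ x, constraint C x * (w x • condMean p x f - f) := rfl

theorem generator_apply (f : Config d n → ℝ) :
    generator p C f = ∑ x, constraint C x * (condMean p x f - f) := by
  funext σ
  simp only [Finset.sum_apply, Pi.mul_apply, Pi.sub_apply]
  rfl

theorem generator_eq_killedGenerator : generator p C = killedGenerator p C 1 := by
  ext1 f
  rw [killedGenerator_apply, generator_apply]
  simp

theorem exp_killedGenerator_nonneg (hp0 : 0 < p) (hp1 : p < 1) {w : Site d n → ℝ} (hw : 0 ≤ w)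
    {t : ℝ} (ht : 0 ≤ t) {f : Config d n → ℝ} (hf : 0 ≤ f) :
    0 ≤ NormedSpace.exp (t • killedGenerator p C w) f := by
  -- Each site loses mass at rate at most `1`, so adding one copy of `g` per site compensates all
  -- the negative terms.
  refine exp_apply_nonneg (K := t * Fintype.card (Site d n)) (fun g hg => ?_) hf
  have h : (t • killedGenerator p C w) g + (t * (Fintype.card (Site d n) : ℝ)) • g
      = t • ∑ x, (constraint C x * (w x • condMean p x g - g) + g) := by
    rw [Finset.sum_add_distrib, Finset.sum_const, Finset.card_univ, smul_add, mul_smul,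
      ← Nat.cast_smul_eq_nsmul ℝ, _root_.smul_apply, killedGenerator_apply]
  rw [h]
  refine smul_nonneg ht (Finset.sum_nonneg fun x _ σ => ?_)
  have h1 : 0 ≤ condMean p x g := by
    simpa [condMean_zero] using condMean_mono hp0 hp1 x hg
  have e : (constraint C x * (w x • condMean p x g - g) + g) σ
      = constraint C x σ * (w x * condMean p x g σ) + (1 - constraint C x σ) * g σ := by
    simp only [Pi.add_apply, Pi.mul_apply, Pi.sub_apply, Pi.smul_apply, smul_eq_mul]
    ring
  rw [e]
  exact add_nonneg (mul_nonneg (constraint_nonneg x σ) (mul_nonneg (hw x) (h1 σ)))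
    (mul_nonneg (sub_nonneg.2 (constraint_le_one x σ)) (hg σ))

theorem semigroup_nonneg (hp0 : 0 < p) (hp1 : p < 1) {t : ℝ} (ht : 0 ≤ t)
    {f : Config d n → ℝ} (hf : 0 ≤ f) : 0 ≤ semigroup p C t f := by
  rw [semigroup, generator_eq_killedGenerator]
  exact exp_killedGenerator_nonneg hp0 hp1 zero_le_one ht hf

theorem semigroup_mono (hp0 : 0 < p) (hp1 : p < 1) {t : ℝ} (ht : 0 ≤ t)
    {f g : Config d n → ℝ} (h : f ≤ g) : semigroup p C t f ≤ semigroup p C t g := by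
  have h1 := semigroup_nonneg (C := C) hp0 hp1 ht (sub_nonneg.2 h)
  rw [map_sub] at h1
  exact sub_nonneg.1 h1

theorem generator_const (a : ℝ) : generator p C (fun _ => a) = 0 := by
  simp [generator_apply, condMean_const]

theorem semigroup_const (t a : ℝ) : semigroup p C t (fun _ => a) = fun _ => a := by
  have h := exp_apply_eq_of_eqOn (A := t • generator p C) (B := 0)
    (S := Set.range fun (a : ℝ) (_ : Config d n) => a) (v := fun _ => a)
    (fun v _ => ⟨0, rfl⟩) (by
      rintro _ ⟨b, rfl⟩
      simp [generator_const]) ⟨a, rfl⟩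
  rw [semigroup, h]
  simp

theorem semigroup_add (s t : ℝ) (f : Config d n → ℝ) :
    semigroup p C (s + t) f = semigroup p C s (semigroup p C t f) := by
  simp only [semigroup]
  rw [add_smul, exp_add_of_commute_real
    (((Commute.refl (generator p C)).smul_left s).smul_right t)]
  rfl

/-- Since `c_x` does not involve the spin at `x`, it comes out of `condMean p x`, which annihilates
`condMean p x f - f`. -/
theorem mean_generator (hC : ∀ x, x ∉ C x) (f : Config d n → ℝ) :
    mean p (generator p C f) = 0 := by
  rw [generator_apply, mean_sum]
  refine Finset.sum_eq_zero fun x _ => ?_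
  rw [← mean_condMean x, condMean_mul_of_dependsOn (dependsOn_constraint x) (hC x), condMean_sub,
    condMean_condMean, sub_self, mul_zero]
  exact mean_const 0

theorem mean_semigroup (hC : ∀ x, x ∉ C x) (t : ℝ) (f : Config d n → ℝ) :
    mean p (semigroup p C t f) = mean p f := by
  refine comp_exp_eq_of_comp_eq_zero (T := meanCLM p) (fun v => ?_) f
  rw [_root_.smul_apply, map_smul, meanCLM_apply, mean_generator hC, smul_zero]

/-- The subspace of functions depending only on the spins in `S`. -/
def dependsOnSubmodule (S : Set (Site d n)) : Submodule ℝ (Config d n → ℝ) where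
  carrier := {f | DependsOn f S}
  add_mem' hf hg := fun σ τ h => by rw [Pi.add_apply, Pi.add_apply, hf h, hg h]
  zero_mem' := fun _ _ _ => rfl
  smul_mem' a f hf := fun σ τ h => by rw [Pi.smul_apply, Pi.smul_apply, hf h]

/-- A site outside `S` acts trivially if it is not killed. If it is killed, its term is a multiple
of `c_y f`, so only `C y ⊆ S` is needed, not `y ∈ S`. -/
theorem dependsOn_killedGenerator {w : Site d n → ℝ} {S : Set (Site d n)}
    (hS : ∀ y, (C y : Set (Site d n)) ⊆ S ∨ (y ∉ S ∧ w y = 1)) {f : Config d n → ℝ}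
    (hf : DependsOn f S) : DependsOn (killedGenerator p C w f) S := by
  rw [killedGenerator_apply]
  refine (dependsOnSubmodule S).sum_mem fun y _ => ?_
  rcases hS y with hy | ⟨hy, hwy⟩
  · intro σ τ h
    simp only [Pi.mul_apply, Pi.sub_apply, Pi.smul_apply]
    rw [dependsOn_constraint y fun i hi => h i (hy hi), hf h,
      dependsOn_condMean hf y fun i hi => h i hi.1]
  · rw [condMean_of_dependsOn hf hy, hwy, one_smul, sub_self, mul_zero]
    exact Submodule.zero_mem _

theorem dependsOn_exp_killedGenerator {w : Site d n → ℝ} {S : Set (Site d n)}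
    (hS : ∀ y, (C y : Set (Site d n)) ⊆ S ∨ (y ∉ S ∧ w y = 1)) {f : Config d n → ℝ}
    (hf : DependsOn f S) (t : ℝ) :
    DependsOn (NormedSpace.exp (t • killedGenerator p C w) f) S :=
  exp_apply_mem (S := dependsOnSubmodule S) (Submodule.closed_of_finiteDimensional _)
    (fun _ hv => Submodule.smul_mem _ t (dependsOn_killedGenerator hS hv)) hf

theorem dependsOn_semigroup {S : Set (Site d n)} (hS : ∀ y ∈ S, (C y : Set (Site d n)) ⊆ S)
    {f : Config d n → ℝ} (hf : DependsOn f S) (t : ℝ) : DependsOn (semigroup p C t f) S := by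
  rw [semigroup, generator_eq_killedGenerator]
  refine dependsOn_exp_killedGenerator (fun y => ?_) hf t
  by_cases hy : y ∈ S
  · exact Or.inl (hS y hy)
  · exact Or.inr ⟨hy, rfl⟩

end Generator

/-! ### Decoupling a site through its first legal update. -/

section Survival

variable {d n : ℕ} {p : ℝ} {C : Site d n → Finset (Site d n)}

/-- A set of sites containing the constraining neighbourhoods of its elements. -/
def IsClosedUnder (C : Site d n → Finset (Site d n)) (S : Set (Site d n)) : Prop :=
  ∀ y ∈ S, (C y : Set (Site d n)) ⊆ S

/-- The generator killed at each legal update of `x`. -/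
def survivalGenerator (p : ℝ) (C : Site d n → Finset (Site d n)) (x : Site d n) :
    (Config d n → ℝ) →L[ℝ] (Config d n → ℝ) :=
  killedGenerator p C fun y => if y = x then 0 else 1

/-- The probability that no legal update of `x` happens before time `t`. -/
def survival (p : ℝ) (C : Site d n → Finset (Site d n)) (x : Site d n) (t : ℝ) :
    Config d n → ℝ :=
  NormedSpace.exp (t • survivalGenerator p C x) fun _ => 1

theorem survivalGenerator_apply (x : Site d n) (f : Config d n → ℝ) :
    survivalGenerator p C x f = generator p C f - constraint C x * condMean p x f := by
  rw [survivalGenerator, killedGenerator_apply, generator_apply, eq_sub_iff_add_eq,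
    ← Finset.add_sum_erase _ _ (Finset.mem_univ x),
    ← Finset.add_sum_erase _ (fun y => constraint C y * (condMean p y f - f)) (Finset.mem_univ x)]
  have h : ∀ y ∈ Finset.univ.erase x,
      constraint C y * ((if y = x then (0 : ℝ) else 1) • condMean p y f - f)
        = constraint C y * (condMean p y f - f) := fun y hy => by
    rw [if_neg (Finset.ne_of_mem_erase hy), one_smul]
  rw [Finset.sum_congr rfl h, if_pos rfl, zero_smul]
  ring

theorem survival_nonneg (hp0 : 0 < p) (hp1 : p < 1) (x : Site d n) {t : ℝ} (ht : 0 ≤ t) :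
    0 ≤ survival p C x t :=
  exp_killedGenerator_nonneg hp0 hp1 (fun y => by dsimp only; split_ifs <;> norm_num) ht
    (fun _ => zero_le_one)

theorem dependsOn_survival {S : Set (Site d n)} (hS : IsClosedUnder C S) {x : Site d n}
    (hCx : (C x : Set (Site d n)) ⊆ S) (t : ℝ) : DependsOn (survival p C x t) S := by
  refine dependsOn_exp_killedGenerator (fun y => ?_) (fun _ _ _ => rfl) t
  by_cases hy : y ∈ S
  · exact Or.inl (hS y hy)
  rcases eq_or_ne y x with rfl | hyx
  · exact Or.inl hCx
  · exact Or.inr ⟨hy, if_neg hyx⟩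

/-- No site of `insert x S` has `x` in its neighbourhood, so averaging over `x` commutes with each
of their updates. -/
theorem condMean_generator_eq_zero {S : Set (Site d n)} (hS : IsClosedUnder C S) {x : Site d n}
    (hx : x ∉ S) (hCx : (C x : Set (Site d n)) ⊆ S) {v : Config d n → ℝ}
    (hv : DependsOn v (insert x S)) (hvx : condMean p x v = 0) :
    condMean p x (generator p C v) = 0 := by
  rw [generator_apply, condMean_sum]
  refine Finset.sum_eq_zero fun y _ => ?_
  by_cases hy : y ∈ insert x S
  · have hCy : (C y : Set (Site d n)) ⊆ S := by
      rcases hy with rfl | hy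
      exacts [hCx, hS y hy]
    rw [condMean_mul_of_dependsOn (dependsOn_constraint y) fun h => hx (hCy h), condMean_sub,
      condMean_comm, hvx, condMean_zero, sub_zero, mul_zero]
  · rw [condMean_of_dependsOn hv hy, sub_self, mul_zero, condMean_zero]

theorem IsClosedUnder.insert {S : Set (Site d n)} (hS : IsClosedUnder C S) {x : Site d n}
    (hCx : (C x : Set (Site d n)) ⊆ S) : IsClosedUnder C (insert x S) := by
  rintro y (rfl | hy)
  exacts [hCx.trans (Set.subset_insert _ _), (hS y hy).trans (Set.subset_insert _ _)]

theorem dependsOn_generator {S : Set (Site d n)} (hS : IsClosedUnder C S) {f : Config d n → ℝ}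
    (hf : DependsOn f S) : DependsOn (generator p C f) S := by
  rw [generator_eq_killedGenerator]
  refine dependsOn_killedGenerator (fun y => ?_) hf
  by_cases hy : y ∈ S
  · exact Or.inl (hS y hy)
  · exact Or.inr ⟨hy, rfl⟩

/-- A legal update of `x` replaces `v` by `condMean p x v = 0`, which is the same as killing the
process, and this class of functions is invariant. -/
theorem semigroup_eq_of_condMean_eq_zero {S : Set (Site d n)} (hS : IsClosedUnder C S)
    {x : Site d n} (hx : x ∉ S) (hCx : (C x : Set (Site d n)) ⊆ S) {v : Config d n → ℝ}
    (hv : DependsOn v (insert x S)) (hvx : condMean p x v = 0) (t : ℝ) :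
    semigroup p C t v = NormedSpace.exp (t • survivalGenerator p C x) v := by
  refine (exp_apply_eq_of_eqOn
    (S := {v | DependsOn v (insert x S) ∧ condMean p x v = 0}) ?_ ?_ ⟨hv, hvx⟩).symm
  · rintro v ⟨h1, h2⟩
    have h3 := condMean_generator_eq_zero hS hx hCx h1 h2
    refine ⟨(dependsOnSubmodule (insert x S)).smul_mem t
      (dependsOn_generator (hS.insert hCx) h1), ?_⟩
    rw [_root_.smul_apply, ← sub_zero (t • _), ← smul_zero t, ← smul_sub]
    funext σ
    have h4 := congrFun h3 σ
    simp only [condMean, Pi.smul_apply, Pi.zero_apply, smul_eq_mul, sub_zero,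
      mul_left_comm _ t] at h4 ⊢
    rw [← Finset.mul_sum, h4, mul_zero]
  · rintro v ⟨-, h2⟩
    rw [_root_.smul_apply, _root_.smul_apply, survivalGenerator_apply, h2, mul_zero, sub_zero]

/-- The fluctuation `f - condMean p x f` is at most `1` and has zero mean at `x`, so it evolves
under the killed semigroup and is dominated by that semigroup applied to `1`, which is `survival`.
-/
theorem semigroup_le_survival_add (hp0 : 0 < p) (hp1 : p < 1) {S : Set (Site d n)}
    (hS : IsClosedUnder C S) {x : Site d n} (hx : x ∉ S) (hCx : (C x : Set (Site d n)) ⊆ S)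
    {f : Config d n → ℝ} (hf : DependsOn f (insert x S)) (hf0 : 0 ≤ f) (hf1 : f ≤ 1)
    {t : ℝ} (ht : 0 ≤ t) :
    semigroup p C t f ≤ survival p C x t + semigroup p C t (condMean p x f) := by
  have h0 : 0 ≤ condMean p x f := by
    simpa [condMean_zero] using condMean_mono hp0 hp1 x hf0
  have hdep : DependsOn (f - condMean p x f) (insert x S) :=
    (dependsOnSubmodule (insert x S)).sub_mem hf
      fun σ τ h => dependsOn_condMean hf x fun i hi => h i hi.1
  have h1 := semigroup_eq_of_condMean_eq_zero hS hx hCx hdep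
    (by rw [condMean_sub, condMean_condMean, sub_self]) t
  have h2 : 0 ≤ NormedSpace.exp (t • survivalGenerator p C x)
      ((fun _ => (1 : ℝ)) - (f - condMean p x f)) := by
    refine exp_killedGenerator_nonneg hp0 hp1 (fun y => by dsimp only; split_ifs <;> norm_num) ht
      fun σ => ?_
    have := h0 σ
    have := hf1 σ
    simp only [Pi.zero_apply, Pi.one_apply, Pi.sub_apply] at *
    linarith
  rw [map_sub, ← h1, map_sub, sub_sub_eq_add_sub, sub_nonneg] at h2
  exact h2

end Survival

/-! ### Convergence layer by layer, and total variation. -/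

section Convergence

variable {d n : ℕ} {p : ℝ} {C : Site d n → Finset (Site d n)}

/-- At time `t`, from any starting configuration, the probabilities of events depending on `S`
exceed their equilibrium values by at most `ε`. -/
def MixedOn (p : ℝ) (C : Site d n → Finset (Site d n)) (S : Set (Site d n)) (t ε : ℝ) : Prop :=
  ∀ f : Config d n → ℝ, DependsOn f S → 0 ≤ f → f ≤ 1 → ∀ σ, semigroup p C t f σ ≤ mean p f + ε

/-- The function `g` is `f` averaged over the spins of `A`. The sites of `A` are peeled off one at a
time, each at the cost of its survival probability. -/
theorem exists_dependsOn_semigroup_le (hp0 : 0 < p) (hp1 : p < 1) {S : Set (Site d n)}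
    (hS : IsClosedUnder C S) {t : ℝ} (ht : 0 ≤ t) (A : Finset (Site d n))
    (hA : ∀ x ∈ A, x ∉ S ∧ (C x : Set (Site d n)) ⊆ S) {f : Config d n → ℝ}
    (hf : DependsOn f (S ∪ A)) (hf0 : 0 ≤ f) (hf1 : f ≤ 1) :
    ∃ g : Config d n → ℝ, DependsOn g S ∧ 0 ≤ g ∧ g ≤ 1 ∧ mean p g = mean p f ∧
      semigroup p C t f ≤ ∑ x ∈ A, survival p C x t + semigroup p C t g := by
  induction A using Finset.induction_on generalizing f with
  | empty => exact ⟨f, by simpa using hf, hf0, hf1, rfl, by simp⟩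
  | insert x A hxA ih =>
    obtain ⟨hxS, hCx⟩ := hA x (Finset.mem_insert_self _ _)
    have hA' : ∀ y ∈ A, y ∉ S ∧ (C y : Set (Site d n)) ⊆ S :=
      fun y hy => hA y (Finset.mem_insert_of_mem hy)
    have hx : x ∉ S ∪ (A : Set (Site d n)) := by
      rintro (h | h)
      exacts [hxS h, hxA h]
    have hclosed : IsClosedUnder C (S ∪ (A : Set (Site d n))) := by
      rintro y (hy | hy)
      exacts [(hS y hy).trans Set.subset_union_left, (hA' y hy).2.trans Set.subset_union_left]
    have hf' : DependsOn f (insert x (S ∪ (A : Set (Site d n)))) := by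
      rwa [Finset.coe_insert, Set.union_insert] at hf
    have h1 := semigroup_le_survival_add hp0 hp1 hclosed hx (hCx.trans Set.subset_union_left)
      hf' hf0 hf1 ht
    have hdep : DependsOn (condMean p x f) (S ∪ (A : Set (Site d n))) := by
      have h := dependsOn_condMean (p := p) hf' x
      rwa [Set.insert_sdiff_self_of_notMem hx] at h
    obtain ⟨g, hg, hg0, hg1, hgm, hle⟩ := ih hA' hdep
      (by simpa [condMean_zero] using condMean_mono hp0 hp1 x hf0)
      (by simpa only [Pi.one_def, condMean_const] using condMean_mono hp0 hp1 x hf1)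
    refine ⟨g, hg, hg0, hg1, hgm.trans (mean_condMean x f), h1.trans ?_⟩
    rw [Finset.sum_insert hxA, add_assoc]
    exact add_le_add le_rfl hle

/-- The final interval `s` turns an event on `S ∪ A` into a function of `S` alone; the mixing of `S`
at time `t` then replaces its expectation by the equilibrium mean, where stationarity removes the
semigroup. -/
theorem MixedOn.union (hp0 : 0 < p) (hp1 : p < 1) (hC : ∀ x, x ∉ C x) {S : Set (Site d n)}
    (hS : IsClosedUnder C S) {A : Finset (Site d n)}
    (hA : ∀ x ∈ A, x ∉ S ∧ (C x : Set (Site d n)) ⊆ S) {s t ε : ℝ} (hs : 0 ≤ s) (ht : 0 ≤ t)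
    (h : MixedOn p C S t ε) :
    MixedOn p C (S ∪ A) (t + s) (ε + ∑ x ∈ A, mean p (survival p C x s)) := by
  intro f hf hf0 hf1 σ
  obtain ⟨g, hg, hg0, hg1, hgm, hle⟩ := exists_dependsOn_semigroup_le hp0 hp1 hS hs A hA hf hf0 hf1
  -- Truncated at `1` because `MixedOn` only tests functions bounded by `1`.
  set H : Config d n → ℝ := (∑ x ∈ A, survival p C x s + semigroup p C s g) ⊓ 1 with hH
  have hdep : DependsOn (∑ x ∈ A, survival p C x s + semigroup p C s g) S :=
    (dependsOnSubmodule S).add_mem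
      ((dependsOnSubmodule S).sum_mem fun x hx => dependsOn_survival hS (hA x hx).2 s)
      (dependsOn_semigroup hS hg s)
  have hH0 : 0 ≤ H := le_inf (add_nonneg
    (Finset.sum_nonneg fun x _ => survival_nonneg hp0 hp1 x hs)
    (semigroup_nonneg hp0 hp1 hs hg0)) zero_le_one
  have hfH : semigroup p C s f ≤ H := le_inf hle
    ((semigroup_mono hp0 hp1 hs hf1).trans (semigroup_const s 1).le)
  have h1 := h H (fun σ τ hστ => by simp only [hH, Pi.inf_apply, hdep hστ]; rfl)
    hH0 inf_le_right σ
  have h2 : mean p H ≤ ∑ x ∈ A, mean p (survival p C x s) + mean p f := by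
    refine (mean_mono hp0 hp1 inf_le_left).trans ?_
    rw [mean_add, mean_sum, mean_semigroup hC, hgm]
  rw [semigroup_add]
  have h3 := semigroup_mono (C := C) hp0 hp1 ht hfH σ
  linarith

theorem mixedOn_layers (hp0 : 0 < p) (hp1 : p < 1) {r : Site d n → ℕ}
    (hr : ∀ x, ∀ y ∈ C x, r y < r x) {s δ : ℝ} (hs : 0 ≤ s)
    (hδ : ∀ x, mean p (survival p C x s) ≤ δ) (k : ℕ) :
    MixedOn p C {x | r x < k} (k * s) ((Finset.univ.filter fun x => r x < k).card * δ) := by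
  induction k with
  | zero =>
    intro f hf hf0 hf1 σ
    -- No site has rank below `0`, so `f` is constant.
    have h : f = fun _ => f σ := by
      funext τ
      exact hf fun i hi => absurd hi (Nat.not_lt_zero _)
    rw [h, semigroup_const, mean_const]
    simp
  | succ k ih =>
    have hC : ∀ x, x ∉ C x := fun x hx => lt_irrefl _ (hr x x hx)
    have hS : IsClosedUnder C {x | r x < k} := fun x hx y hy => (hr x y hy).trans hx
    have h := ih.union (A := Finset.univ.filter fun x => r x = k) hp0 hp1 hC hS (fun x hx => by
      have hx' : r x = k := (Finset.mem_filter.1 hx).2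
      exact ⟨fun h => absurd hx' (ne_of_lt h), fun y hy => hx' ▸ hr x y hy⟩) hs (by positivity)
    have e1 : {x | r x < k + 1} = {x | r x < k} ∪ ↑(Finset.univ.filter fun x => r x = k) := by
      ext x
      simp [Nat.le_iff_lt_or_eq]
    have e2 : (Finset.univ.filter fun x => r x < k + 1).card
        = (Finset.univ.filter fun x => r x < k).card
          + (Finset.univ.filter fun x => r x = k).card := by
      rw [← Finset.card_union_of_disjoint]
      · congr 1
        ext x
        simp [Nat.le_iff_lt_or_eq]
      · exact Finset.disjoint_filter.2 fun x _ h h' => absurd h' (ne_of_lt h)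
    rw [e1, e2]
    intro f hf hf0 hf1 σ
    have h1 := h f hf hf0 hf1 σ
    have h2 := Finset.sum_le_card_nsmul (Finset.univ.filter fun x => r x = k) _ δ
      fun x _ => hδ x
    rw [nsmul_eq_mul] at h2
    push_cast
    rw [add_one_mul]
    linarith

theorem sum_lawAt_mul (ν : Config d n → ℝ) (t : ℝ) (f : Config d n → ℝ) :
    ∑ η, lawAt p C ν t η * f η = ∑ σ, ν σ * semigroup p C t f σ := by
  have h : semigroup p C t f = ∑ η, f η • semigroup p C t (Pi.single η 1) := by
    simp only [← map_smul]
    rw [← map_sum, ← pi_eq_sum_univ' f]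
  rw [h]
  simp only [lawAt, Finset.sum_mul, Finset.sum_apply, Finset.mul_sum, Pi.smul_apply, smul_eq_mul]
  rw [Finset.sum_comm]
  exact Finset.sum_congr rfl fun σ _ => Finset.sum_congr rfl fun η _ => by ring

theorem sum_lawAt {ν : Config d n → ℝ} (hν : ν ∈ stdSimplex ℝ (Config d n)) (t : ℝ) :
    ∑ η, lawAt p C ν t η = 1 := by
  have h := sum_lawAt_mul (p := p) (C := C) ν t fun _ => 1
  rw [semigroup_const] at h
  simpa [hν.2] using h

theorem tvDist_le_of_forall {α β : Config d n → ℝ} (h : ∑ σ, α σ = ∑ σ, β σ) {ε : ℝ}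
    (hε : ∀ f : Config d n → ℝ, 0 ≤ f → f ≤ 1 → ∑ σ, α σ * f σ ≤ ∑ σ, β σ * f σ + ε) :
    tvDist α β ≤ ε := by
  -- The extremal test function is the indicator of `β ≤ α`.
  have h1 := hε (fun σ => if β σ ≤ α σ then 1 else 0)
    (fun σ => by dsimp only; split_ifs <;> norm_num)
    (fun σ => by dsimp only; split_ifs <;> norm_num)
  have h2 : ∑ σ, |α σ - β σ| = 2 * (∑ σ, α σ * (if β σ ≤ α σ then (1 : ℝ) else 0)
      - ∑ σ, β σ * (if β σ ≤ α σ then (1 : ℝ) else 0)) - (∑ σ, α σ - ∑ σ, β σ) := by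
    rw [← Finset.sum_sub_distrib, ← Finset.sum_sub_distrib, Finset.mul_sum,
      ← Finset.sum_sub_distrib]
    refine Finset.sum_congr rfl fun σ _ => ?_
    split_ifs with hc
    · rw [abs_of_nonneg (sub_nonneg.2 hc)]
      ring
    · rw [abs_of_neg (sub_neg.2 (not_le.1 hc))]
      ring
  rw [tvDist, h2, h]
  linarith

theorem sub_le_tvDist {α β : Config d n → ℝ} (h : ∑ σ, α σ = ∑ σ, β σ) {f : Config d n → ℝ}
    (hf0 : 0 ≤ f) (hf1 : f ≤ 1) : ∑ σ, β σ * f σ - ∑ σ, α σ * f σ ≤ tvDist α β := by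
  -- Equal masses allow centring `f` at `1 / 2`, which yields the factor `1 / 2` of `tvDist`.
  have h1 : ∑ σ, β σ * f σ - ∑ σ, α σ * f σ
      = ∑ σ, (α σ - β σ) * (1 / 2 - f σ) - (1 / 2) * (∑ σ, α σ - ∑ σ, β σ) := by
    rw [← Finset.sum_sub_distrib, ← Finset.sum_sub_distrib, Finset.mul_sum,
      ← Finset.sum_sub_distrib]
    exact Finset.sum_congr rfl fun σ _ => by ring
  rw [h1, h, sub_self, mul_zero, sub_zero, tvDist, Finset.mul_sum]
  refine Finset.sum_le_sum fun σ _ => ?_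
  have h2 : |1 / 2 - f σ| ≤ 1 / 2 := by
    have := hf0 σ
    have := hf1 σ
    simp only [Pi.zero_apply, Pi.one_apply] at *
    rw [abs_le]
    constructor <;> linarith
  refine (le_abs_self _).trans ?_
  rw [abs_mul, mul_comm]
  exact mul_le_mul_of_nonneg_right h2 (abs_nonneg _)

theorem MixedOn.tvDist_le {t ε : ℝ} (h : MixedOn p C Set.univ t ε) {ν : Config d n → ℝ}
    (hν : ν ∈ stdSimplex ℝ (Config d n)) : tvDist (lawAt p C ν t) (productMeasure p) ≤ ε := by
  refine tvDist_le_of_forall ((sum_lawAt hν t).trans (sum_productMeasure p).symm)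
    fun f hf0 hf1 => ?_
  rw [sum_lawAt_mul]
  calc ∑ σ, ν σ * semigroup p C t f σ ≤ ∑ σ, ν σ * (mean p f + ε) :=
        Finset.sum_le_sum fun σ _ =>
          mul_le_mul_of_nonneg_left (h f (dependsOn_univ f) hf0 hf1 σ) (hν.1 σ)
    _ = mean p f + ε := by rw [← Finset.sum_mul, hν.2, one_mul]

end Convergence

/-! ### Exponential decay of the stationary survival probability from the spectral gap. -/

section Relaxation

variable {d n : ℕ} {p : ℝ} {C : Site d n → Finset (Site d n)}

theorem var_eq (f : Config d n → ℝ) : var p f = mean p (f ^ 2) - mean p f ^ 2 := by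
  have h : (fun σ => (f σ - mean p f) ^ 2)
      = f ^ 2 - (2 * mean p f) • f + fun _ => mean p f ^ 2 := by
    funext σ
    simp only [Pi.add_apply, Pi.sub_apply, Pi.smul_apply, Pi.pow_apply, smul_eq_mul]
    ring
  rw [var, h, mean_add, mean_sub, mean_smul, mean_const]
  ring

theorem var_nonneg (hp0 : 0 < p) (hp1 : p < 1) (f : Config d n → ℝ) : 0 ≤ var p f :=
  Finset.sum_nonneg fun σ _ => mul_nonneg (productMeasure_nonneg hp0 hp1 σ) (sq_nonneg _)

theorem mul_var_le_dirichletForm (hp0 : 0 < p) (hp1 : p < 1) {lam : ℝ} (hlam : 0 < lam)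
    (h : lam ≤ spectralGap p C) (f : Config d n → ℝ) : lam * var p f ≤ dirichletForm p C f := by
  by_cases hf : ∃ a : ℝ, ∀ σ, f σ = a
  · obtain ⟨a, ha⟩ := hf
    obtain rfl : f = fun _ => a := funext ha
    have h1 : var p (fun _ : Config d n => a) = 0 := by
      rw [var_eq, mean_const, sub_eq_zero]
      exact mean_const (a ^ 2)
    have h2 : dirichletForm p C (fun _ => a) = 0 := by
      rw [dirichletForm, generator_const]
      simp [mean]
    rw [h1, h2, mul_zero]
  · have hbdd : BddBelow (Set.range fun f : {f : Config d n → ℝ // ¬ ∃ a : ℝ, ∀ σ, f σ = a} =>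
        dirichletForm p C f.1 / var p f.1) := by
      -- A real infimum over a set unbounded below is `0` by convention, which `0 < lam` excludes.
      by_contra hb
      rw [spectralGap, Real.iInf_of_not_bddBelow hb] at h
      exact absurd h (not_le.2 hlam)
    have h1 : lam ≤ dirichletForm p C f / var p f := h.trans (ciInf_le hbdd ⟨f, hf⟩)
    have hpos : 0 < var p f := by
      refine (var_nonneg hp0 hp1 f).lt_of_ne' fun h0 => ?_
      rw [h0, div_zero] at h1
      exact absurd h1 (not_le.2 hlam)
    exact (le_div_iff₀ hpos).1 h1

/-- The exponential rate at which an update with constraint probability at least `q` becomes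
likely, when the spectral gap is at least `lam`. -/
def relaxationRate (lam q : ℝ) : ℝ := min 1 (lam / 2) * q / 2

theorem relaxationRate_pos {lam q : ℝ} (hlam : 0 < lam) (hq : 0 < q) :
    0 < relaxationRate lam q := by
  unfold relaxationRate
  have : 0 < min 1 (lam / 2) := lt_min one_pos (by linarith)
  positivity

/-- Only the fraction `θ` of `F` is used: its loss `θ v` is covered by half of `lam v ≥ 2 θ v`, and
the other half controls the variance part of `v + m ^ 2`. -/
theorem rate_mul_secondMoment_le {θ lam q m v c D F : ℝ} (hθ0 : 0 < θ) (hθ1 : θ ≤ 1)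
    (hθ2 : θ ≤ lam / 2) (hq0 : 0 < q) (hq1 : q ≤ 1) (hq : q ≤ c) (hv : 0 ≤ v) (hD : lam * v ≤ D)
    (hF : m ^ 2 / 2 * c - v ≤ F) (hF0 : 0 ≤ F) : θ * q / 2 * (v + m ^ 2) ≤ D + F := by
  have h4 : θ * F ≤ F := mul_le_of_le_one_left hF0 hθ1
  have h5 : m ^ 2 / 2 * q ≤ m ^ 2 / 2 * c := mul_le_mul_of_nonneg_left hq (by positivity)
  have h6 : θ * (m ^ 2 / 2 * q - v) ≤ θ * F := mul_le_mul_of_nonneg_left (by linarith) hθ0.le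
  have h7 : θ * q * v ≤ θ * v :=
    mul_le_mul_of_nonneg_right (mul_le_of_le_one_right hθ0.le hq1) hv
  have h8 : (2 * θ) * v ≤ lam * v := mul_le_mul_of_nonneg_right (by linarith) hv
  have h9 : 0 ≤ θ * q * v := by positivity
  linarith

/-- A function with small Dirichlet form is close to its mean `m`, so the killing term is about `m ^
2` times the constraint probability. Precisely, `f ^ 2 ≥ m ^ 2 / 2 - (f - m) ^ 2`, which is `(2 f -
m) ^ 2 ≥ 0`. -/
theorem relaxationRate_mul_le (hp0 : 0 < p) (hp1 : p < 1) {lam q : ℝ} (hlam : 0 < lam)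
    (h : lam ≤ spectralGap p C) {x : Site d n} (hq0 : 0 < q) (hq1 : q ≤ 1)
    (hq : q ≤ mean p (constraint C x)) (f : Config d n → ℝ) :
    relaxationRate lam q * mean p (f ^ 2)
      ≤ dirichletForm p C f + mean p (constraint C x * f ^ 2) := by
  set θ := min 1 (lam / 2) with hθ
  set m := mean p f with hm
  have hθ0 : 0 < θ := lt_min one_pos (by linarith)
  have hθ1 : θ ≤ 1 := min_le_left _ _
  have hθ2 : θ ≤ lam / 2 := min_le_right _ _
  have hv := var_nonneg hp0 hp1 f
  have hD := mul_var_le_dirichletForm hp0 hp1 hlam h f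
  have hsq : mean p (f ^ 2) = var p f + m ^ 2 := by rw [var_eq]; ring
  have hc : (m ^ 2 / 2) * mean p (constraint C x) - var p f ≤ mean p (constraint C x * f ^ 2) := by
    rw [← mean_smul, var, ← mean_sub]
    refine mean_mono hp0 hp1 fun σ => ?_
    have h0 := constraint_nonneg (C := C) x σ
    have h1 := constraint_le_one (C := C) x σ
    simp only [Pi.sub_apply, Pi.smul_apply, Pi.mul_apply, Pi.pow_apply, smul_eq_mul, ← hm]
    have h2 : 0 ≤ constraint C x σ * (2 * f σ - m) ^ 2 := mul_nonneg h0 (sq_nonneg _)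
    have h3 : 0 ≤ (1 - constraint C x σ) * (f σ - m) ^ 2 :=
      mul_nonneg (sub_nonneg.2 h1) (sq_nonneg _)
    linarith
  have hc0 : 0 ≤ mean p (constraint C x * f ^ 2) :=
    Finset.sum_nonneg fun σ _ => mul_nonneg (productMeasure_nonneg hp0 hp1 σ)
      (mul_nonneg (constraint_nonneg x σ) (sq_nonneg _))
  rw [hsq, relaxationRate, ← hθ]
  exact rate_mul_secondMoment_le hθ0 hθ1 hθ2 hq0 hq1 hq hv hD hc hc0

theorem sq_mean_le (hp0 : 0 < p) (hp1 : p < 1) (f : Config d n → ℝ) :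
    mean p f ^ 2 ≤ mean p (f ^ 2) := by
  have h1 := var_nonneg hp0 hp1 f
  rw [var_eq] at h1
  linarith

/-- The survival function `u` does not depend on the spin at `x`, so half the derivative of `mean p
(u ^ 2)` is minus the Dirichlet form minus `mean p (c_x u ^ 2)`. The previous inequality gives
exponential decay of the second moment, and Cauchy–Schwarz passes to the mean. -/
theorem mean_survival_le (hp0 : 0 < p) (hp1 : p < 1) {lam q : ℝ} (hlam : 0 < lam)
    (h : lam ≤ spectralGap p C) {S : Set (Site d n)} (hS : IsClosedUnder C S) {x : Site d n}
    (hx : x ∉ S) (hCx : (C x : Set (Site d n)) ⊆ S) (hq0 : 0 < q) (hq1 : q ≤ 1)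
    (hq : q ≤ mean p (constraint C x)) {t : ℝ} (ht : 0 ≤ t) :
    mean p (survival p C x t) ≤ Real.exp (-(relaxationRate lam q * t)) := by
  set μ := relaxationRate lam q
  set u : ℝ → Config d n → ℝ := survival p C x with hu
  have hder : ∀ s : ℝ, HasDerivAt (fun s => mean p (u s ^ 2))
      (2 * mean p (u s * survivalGenerator p C x (u s))) s := by
    intro s
    have h1 : ∀ σ, HasDerivAt (fun s => u s σ) (survivalGenerator p C x (u s) σ) s := fun σ =>
      hasDerivAt_pi.1 (hasDerivAt_exp_smul_apply (survivalGenerator p C x) (fun _ => 1) s) σ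
    have h2 : HasDerivAt (fun s => ∑ σ, productMeasure p σ * u s σ ^ 2)
        (∑ σ, productMeasure p σ * (2 * (u s σ * survivalGenerator p C x (u s) σ))) s := by
      refine HasDerivAt.fun_sum fun σ _ => HasDerivAt.const_mul _ ?_
      refine ((h1 σ).fun_pow 2).congr_deriv ?_
      push_cast
      ring
    refine h2.congr_deriv ?_
    rw [mean, Finset.mul_sum]
    exact Finset.sum_congr rfl fun σ _ => by simp only [Pi.mul_apply]; ring
  have hdecay : ∀ s : ℝ, 2 * mean p (u s * survivalGenerator p C x (u s))
      ≤ -(2 * μ) * mean p (u s ^ 2) := by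
    intro s
    have h1 : condMean p x (u s) = u s :=
      condMean_of_dependsOn (dependsOn_survival hS hCx s) hx
    have h2 := relaxationRate_mul_le hp0 hp1 hlam h hq0 hq1 hq (u s)
    have h3 : u s * survivalGenerator p C x (u s)
        = (fun σ => u s σ * generator p C (u s) σ) - constraint C x * u s ^ 2 := by
      rw [survivalGenerator_apply, h1]
      funext σ
      simp only [Pi.mul_apply, Pi.sub_apply, Pi.pow_apply]
      ring
    rw [h3, mean_sub]
    rw [dirichletForm] at h2
    linarith
  have hder2 : ∀ s : ℝ, HasDerivAt (fun s => Real.exp (2 * μ * s) * mean p (u s ^ 2))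
      (Real.exp (2 * μ * s) * (2 * μ * mean p (u s ^ 2)
        + 2 * mean p (u s * survivalGenerator p C x (u s)))) s := by
    intro s
    have h1 : HasDerivAt (fun s : ℝ => Real.exp (2 * μ * s)) (Real.exp (2 * μ * s) * (2 * μ)) s := by
      simpa using ((hasDerivAt_id s).const_mul (2 * μ)).exp
    exact (h1.mul (hder s)).congr_deriv (by ring)
  have hanti : Antitone (fun s => Real.exp (2 * μ * s) * mean p (u s ^ 2)) := by
    refine antitone_of_deriv_nonpos (fun s => (hder2 s).differentiableAt) fun s => ?_
    rw [(hder2 s).deriv]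
    have := hdecay s
    exact mul_nonpos_of_nonneg_of_nonpos (Real.exp_pos _).le (by linarith)
  have h0 : mean p (u 0 ^ 2) = 1 := by
    have e : u 0 ^ 2 = fun _ => 1 := by
      funext σ
      simp [hu, survival]
    rw [e, mean_const]
  have h1 : Real.exp (2 * μ * t) * mean p (u t ^ 2) ≤ 1 := by
    have := hanti ht
    simpa [h0] using this
  have h2 : mean p (u t ^ 2) ≤ Real.exp (-(μ * t)) ^ 2 := by
    have h3 := mul_le_mul_of_nonneg_left h1 (Real.exp_pos (-(2 * μ * t))).le
    rw [← mul_assoc, ← Real.exp_add, neg_add_cancel, Real.exp_zero, one_mul, mul_one] at h3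
    rw [← Real.exp_nat_mul]
    refine h3.trans_eq ?_
    congr 1
    push_cast
    ring
  exact (le_abs_self _).trans (abs_le_of_sq_le_sq ((sq_mean_le hp0 hp1 _).trans h2) (Real.exp_pos _).le)

end Relaxation

/-! ### Geometry of the oriented neighbourhoods. -/

section Geometry

variable {d n : ℕ} {C : Site d n → Finset (Site d n)}

/-- The distance of a site from the corner `(1,…,1)`, shifted by `d`. -/
def siteRank (x : Site d n) : ℕ := (∑ i, x.1 i).toNat

theorem one_le_coord (x : Site d n) (i : Fin d) : 1 ≤ x.1 i :=
  (Finset.mem_Icc.1 (Fintype.mem_piFinset.1 x.2 i)).1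

theorem coord_le (x : Site d n) (i : Fin d) : x.1 i ≤ n :=
  (Finset.mem_Icc.1 (Fintype.mem_piFinset.1 x.2 i)).2

theorem IsConstraining.coord_sub (hC : IsConstraining C) {x y : Site d n} (hy : y ∈ C x) :
    (∀ i, x.1 i - y.1 i = 0 ∨ x.1 i - y.1 i = 1) ∧ ∃ i, x.1 i - y.1 i = 1 := by
  have hx : x.1 ≠ 1 := fun h => by simp [(hC x).1 h] at hy
  obtain ⟨⟨α, hα, he⟩, hne⟩ := ((hC x).2 hx).2 y hy
  have hsub : ∀ i, x.1 i - y.1 i = α i := fun i => by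
    rw [he]
    simp [Finset.sum_apply, Pi.single_apply]
  refine ⟨fun i => hsub i ▸ hα i, ?_⟩
  by_contra! hcon
  refine hne (funext fun i => ?_)
  rcases hα i with h | h
  · linarith [hsub i]
  · exact absurd ((hsub i).trans h) (hcon i)

theorem IsConstraining.siteRank_lt (hC : IsConstraining C) (x : Site d n) :
    ∀ y ∈ C x, siteRank y < siteRank x := by
  intro y hy
  obtain ⟨h1, i, hi⟩ := hC.coord_sub hy
  have hlt : ∑ i, y.1 i < ∑ i, x.1 i :=
    Finset.sum_lt_sum (fun j _ => by rcases h1 j with h | h <;> linarith)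
      ⟨i, Finset.mem_univ i, by linarith⟩
  have h0 : 0 ≤ ∑ i, y.1 i := Finset.sum_nonneg fun j _ => by linarith [one_le_coord y j]
  unfold siteRank
  omega

theorem siteRank_le (x : Site d n) : siteRank x ≤ d * n := by
  have h : ∑ i, x.1 i ≤ ∑ _i : Fin d, (n : ℤ) := Finset.sum_le_sum fun i _ => coord_le x i
  rw [Finset.sum_const, Finset.card_univ, Fintype.card_fin, nsmul_eq_mul] at h
  unfold siteRank
  rw [Int.toNat_le]
  exact_mod_cast h

theorem IsConstraining.card_le (hC : IsConstraining C) (x : Site d n) : (C x).card ≤ 2 ^ d := by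
  have h : (Fintype.piFinset fun _ : Fin d => ({0, 1} : Finset ℤ)).card = 2 ^ d := by
    rw [Fintype.card_piFinset]
    simp
  rw [← h]
  refine Finset.card_le_card_of_injOn (fun y i => x.1 i - y.1 i) (fun y hy => ?_) ?_
  · rw [Finset.mem_coe, Fintype.mem_piFinset]
    intro i
    simpa using (hC.coord_sub hy).1 i
  · intro y _ z _ h
    refine Subtype.ext (funext fun i => ?_)
    have := congrFun h i
    simp only at this
    linarith

theorem card_site : Fintype.card (Site d n) = n ^ d := by
  simp

end Geometry

/-! ### Distance to equilibrium after `d n + 1` intervals. -/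

section UpperBound

variable {d n : ℕ} {p : ℝ} {C : Site d n → Finset (Site d n)}

theorem tvDist_lawAt_le (hp0 : 0 < p) (hp1 : p < 1) (hC : IsConstraining C) {lam : ℝ}
    (hlam : 0 < lam) (h : lam ≤ spectralGap p C) {s : ℝ} (hs : 0 ≤ s) {ν : Config d n → ℝ}
    (hν : ν ∈ stdSimplex ℝ (Config d n)) :
    tvDist (lawAt p C ν ((d * n + 1 : ℕ) * s)) (productMeasure p)
      ≤ (n : ℝ) ^ d * Real.exp (-(relaxationRate lam ((1 - p) ^ 2 ^ d) * s)) := by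
  have hq0 : 0 < 1 - p := sub_pos.2 hp1
  have hδ : ∀ x, mean p (survival p C x s)
      ≤ Real.exp (-(relaxationRate lam ((1 - p) ^ 2 ^ d) * s)) := fun x =>
    -- Sites of strictly smaller rank form a closed set containing `C x` but not `x`.
    mean_survival_le (S := {y | siteRank y < siteRank x}) hp0 hp1 hlam h
      (fun y hy z hz => (hC.siteRank_lt y z hz).trans hy) (lt_irrefl (siteRank x)) (hC.siteRank_lt x)
      (by positivity) (pow_le_one₀ hq0.le (by linarith))
      (by
        rw [mean_constraint]
        exact pow_le_pow_of_le_one hq0.le (by linarith) (hC.card_le x)) hs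
  have h1 := mixedOn_layers hp0 hp1 hC.siteRank_lt hs hδ (d * n + 1)
  have h2 : ∀ x : Site d n, siteRank x < d * n + 1 := fun x => Nat.lt_succ_of_le (siteRank_le x)
  have e1 : {x : Site d n | siteRank x < d * n + 1} = Set.univ := Set.eq_univ_of_forall h2
  have e2 : (Finset.univ.filter fun x : Site d n => siteRank x < d * n + 1) = Finset.univ :=
    Finset.filter_true_of_mem fun x _ => h2 x
  rw [e1, e2, Finset.card_univ, card_site] at h1
  have h3 := h1.tvDist_le hν
  push_cast at h3 ⊢
  exact h3

end UpperBound

/-! ### Finite speed of propagation of zeros. -/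

section LowerBound

variable {d n : ℕ} {p : ℝ} {C : Site d n → Finset (Site d n)}

theorem mean_sub_semigroup_le_tvDist (t : ℝ) (σ : Config d n) {f : Config d n → ℝ}
    (hf0 : 0 ≤ f) (hf1 : f ≤ 1) :
    mean p f - semigroup p C t f σ
      ≤ tvDist (lawAt p C (Pi.single σ 1) t) (productMeasure p) := by
  have h := sub_le_tvDist (α := lawAt p C (Pi.single σ 1) t)
    ((sum_lawAt (single_mem_stdSimplex ℝ σ) t).trans (sum_productMeasure p).symm) hf0 hf1
  rw [sum_lawAt_mul] at h
  simpa [Pi.single_apply, mean] using h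

theorem generator_of_dependsOn_singleton {x : Site d n} {f : Config d n → ℝ}
    (hf : DependsOn f {x}) : generator p C f = constraint C x * (condMean p x f - f) := by
  rw [generator_apply]
  refine Finset.sum_eq_single x (fun y _ hyx => ?_) fun h => absurd (Finset.mem_univ x) h
  rw [condMean_of_dependsOn hf (by simpa using hyx), sub_self, mul_zero]

theorem semigroup_le_of_generator_le (hp0 : 0 < p) (hp1 : p < 1) {f : Config d n → ℝ} {κ : ℝ}
    (hf : generator p C f ≤ κ • f) {t : ℝ} (ht : 0 ≤ t) :
    semigroup p C t f ≤ Real.exp (κ * t) • f :=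
  exp_smul_apply_le (fun _ hs _ hg => semigroup_nonneg hp0 hp1 hs hg) hf ht

/-- An unconstrained spin relaxes exactly like `exp (-t)`. Started from its less likely value, it
leaves the likelier one with a deficit of at least `exp (-t) / 2`. This covers small `n`. -/
theorem log_two_le_of_tvDist_le (hp0 : 0 < p) (hp1 : p < 1) {x : Site d n} (hx : C x = ∅) {t : ℝ}
    (ht : 0 ≤ t) (h : ∀ ν ∈ stdSimplex ℝ (Config d n),
      tvDist (lawAt p C ν t) (productMeasure p) ≤ 1 / 4) : Real.log 2 ≤ t := by
  obtain ⟨s, s', hss, hs⟩ : ∃ s s' : Fin 2, s' ≠ s ∧ 1 / 2 ≤ bernoulli p s := by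
    rcases le_total p (1 / 2) with hp | hp
    · exact ⟨0, 1, by decide, by simp only [bernoulli]; norm_num; linarith⟩
    · exact ⟨1, 0, by decide, by simpa [bernoulli] using hp⟩
  set b := bernoulli p s
  set f : Config d n → ℝ := fun σ => if σ x = s then 1 else 0 with hf
  have hdep : DependsOn f {x} := fun σ τ h => by simp only [hf, h x rfl]
  have hcond : condMean p x f = fun _ => b := by
    funext σ
    simp [condMean, hf, b]
  have hmean : mean p f = b := by rw [← mean_condMean x, hcond, mean_const]
  have hgen : generator p C (f - fun _ => b) ≤ (-1 : ℝ) • (f - fun _ => b) := by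
    rw [map_sub, generator_const, sub_zero, generator_of_dependsOn_singleton hdep, hcond]
    refine le_of_eq (funext fun σ => ?_)
    simp [constraint, hx]
  have h1 := semigroup_le_of_generator_le hp0 hp1 hgen ht fun _ => s'
  rw [map_sub, semigroup_const] at h1
  have h2 := (mean_sub_semigroup_le_tvDist (p := p) (C := C) t (fun _ => s') (f := f)
    (fun σ => by simp only [hf, Pi.zero_apply]; split_ifs <;> norm_num)
    (fun σ => by simp only [hf, Pi.one_apply]; split_ifs <;> norm_num)).trans
    (h _ (single_mem_stdSimplex ℝ _))
  have h3 : f (fun _ => s') = 0 := if_neg hss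
  simp only [Pi.sub_apply, Pi.smul_apply, smul_eq_mul, h3] at h1
  rw [hmean] at h2
  have h4 : Real.exp (-1 * t) * (1 / 2) ≤ 1 / 4 :=
    (mul_le_mul_of_nonneg_left hs (Real.exp_pos _).le).trans (by linarith)
  have h5 : Real.exp (-t) ≤ 1 / 2 := by
    rw [neg_one_mul] at h4
    linarith
  rw [Real.log_le_iff_le_exp two_pos]
  rw [Real.exp_neg, one_div] at h5
  exact (inv_le_inv₀ (Real.exp_pos t) two_pos).1 h5

/-- The indicator that the spin at `x` is `0`. -/
def zeroAt (x : Site d n) (σ : Config d n) : ℝ := 1 - ((σ x : ℕ) : ℝ)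

theorem zeroAt_nonneg (x : Site d n) (σ : Config d n) : 0 ≤ zeroAt x σ :=
  (spin_compl_mem_Icc (σ x)).1

theorem generator_zeroAt_le (hp0 : 0 < p) (x : Site d n) :
    generator p C (zeroAt x) ≤ constraint C x := by
  have hdep : DependsOn (zeroAt x) ({x} : Set (Site d n)) := fun σ τ h => by
    simp only [zeroAt, h x rfl]
  have hcond : condMean p x (zeroAt x) = fun _ => 1 - p := by
    funext σ
    simp [condMean, zeroAt, bernoulli, Fin.sum_univ_two]
  rw [generator_of_dependsOn_singleton hdep, hcond]
  intro σ
  refine mul_le_of_le_one_right (constraint_nonneg x σ) ?_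
  have := zeroAt_nonneg x σ
  simp only [Pi.sub_apply]
  linarith

/-- A weighted count of the zeros along a sequence of sites. -/
def chainWeight (z : ℕ → Site d n) (N : ℕ) : Config d n → ℝ :=
  ∑ i ∈ Finset.range N, ((1 / 2 : ℝ) ^ i) • zeroAt (z i) + fun _ => (1 / 2 : ℝ) ^ N

/-- A zero at `z i` appears at rate at most `c_(z i) ≤ zeroAt (z (i + 1))`, whose weight is half
that of `z i`; hence the factor `2`. The last site has no successor in the chain, and the constant
`(1 / 2) ^ N` pays for it. -/
theorem generator_chainWeight_le (hp0 : 0 < p) {z : ℕ → Site d n} {N : ℕ} (hN : 1 ≤ N)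
    (hz : ∀ i, i + 1 < N → z (i + 1) ∈ C (z i)) :
    generator p C (chainWeight z N) ≤ (2 : ℝ) • chainWeight z N := by
  obtain ⟨M, rfl⟩ := Nat.exists_eq_add_of_le' hN
  intro σ
  have h1 : generator p C (chainWeight z (M + 1)) σ
      ≤ ∑ i ∈ Finset.range (M + 1), (1 / 2 : ℝ) ^ i * constraint C (z i) σ := by
    rw [chainWeight, map_add, generator_const, add_zero, map_sum, Finset.sum_apply]
    refine Finset.sum_le_sum fun i _ => ?_
    rw [map_smul, Pi.smul_apply, smul_eq_mul]
    exact mul_le_mul_of_nonneg_left (generator_zeroAt_le hp0 (z i) σ) (by positivity)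
  refine h1.trans ?_
  have h2 : ∑ i ∈ Finset.range M, (1 / 2 : ℝ) ^ i * constraint C (z i) σ
      ≤ 2 * ∑ i ∈ Finset.range M, (1 / 2 : ℝ) ^ (i + 1) * zeroAt (z (i + 1)) σ := by
    rw [Finset.mul_sum]
    refine Finset.sum_le_sum fun i hi => ?_
    have h3 : constraint C (z i) σ ≤ zeroAt (z (i + 1)) σ :=
      constraint_le_of_mem (hz i (by simpa using hi)) σ
    rw [pow_succ]
    have h4 := mul_le_mul_of_nonneg_left h3 (by positivity : (0 : ℝ) ≤ (1 / 2) ^ i)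
    linarith
  have h5 : (1 / 2 : ℝ) ^ M * constraint C (z M) σ ≤ (1 / 2 : ℝ) ^ M :=
    mul_le_of_le_one_right (by positivity) (constraint_le_one _ σ)
  have h6 := zeroAt_nonneg (z 0) σ
  rw [Finset.sum_range_succ]
  simp only [chainWeight, Pi.smul_apply, Pi.add_apply, Finset.sum_apply, smul_eq_mul]
  rw [Finset.sum_range_succ', pow_zero, one_mul, pow_succ (1 / 2 : ℝ) M]
  linarith

/-- The event tested is a zero among the first `m` chain sites. Its equilibrium probability is `1 -
p ^ m ≥ 3 / 4`, while its indicator is at most `2 ^ m • chainWeight z N`, whose mean from all ones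
is at most `2 ^ m * exp (2 t) * (1 / 2) ^ N`. -/
theorem le_exp_of_tvDist_le (hp0 : 0 < p) (hp1 : p < 1) {z : ℕ → Site d n} {m N : ℕ}
    (hN : 1 ≤ N) (hmN : m ≤ N) (hpm : p ^ m ≤ 1 / 4) (hz : ∀ i, i + 1 < N → z (i + 1) ∈ C (z i))
    (hinj : Set.InjOn z (Finset.range m)) {t : ℝ} (ht : 0 ≤ t)
    (h : ∀ ν ∈ stdSimplex ℝ (Config d n),
      tvDist (lawAt p C ν t) (productMeasure p) ≤ 1 / 4) :
    (2 : ℝ) ^ N ≤ 2 ^ (m + 1) * Real.exp (2 * t) := by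
  let g : Site d n → Fin 2 → ℝ :=
    fun x s => if x ∈ (Finset.range m).image z then ((s : ℕ) : ℝ) else 1
  have hg0 : ∀ x s, 0 ≤ g x s := fun x s => by
    simp only [g]
    split_ifs <;> positivity
  have hg1 : ∀ x s, g x s ≤ 1 := fun x s => by
    simp only [g]
    split_ifs
    · fin_cases s <;> simp
    · exact le_rfl
  let f : Config d n → ℝ := fun σ => ∏ x, g x (σ x)
  have hf0 : 0 ≤ f := fun σ => Finset.prod_nonneg fun x _ => hg0 x _
  have hf1 : f ≤ 1 := fun σ => Finset.prod_le_one (fun x _ => hg0 x _) fun x _ => hg1 x _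
  have hmean : mean p f = p ^ m := by
    have hs : ∀ x, ∑ s : Fin 2, bernoulli p s * g x s
        = if x ∈ (Finset.range m).image z then p else 1 := by
      intro x
      simp only [g]
      split_ifs
      · simp [Fin.sum_univ_two, bernoulli]
      · simpa using sum_bernoulli p
    rw [mean_prod, Finset.prod_congr rfl fun x _ => hs x, Finset.prod_ite_mem, Finset.univ_inter,
      Finset.prod_const, Finset.card_image_of_injOn hinj, Finset.card_range]
  have hle : (fun _ => 1) - f ≤ (2 : ℝ) ^ m • chainWeight z N := by
    intro σ
    have hw : ∀ i ∈ Finset.range N, 0 ≤ (((1 / 2 : ℝ) ^ i) • zeroAt (z i)) σ := fun i _ =>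
      mul_nonneg (by positivity) (zeroAt_nonneg _ _)
    have hw0 : 0 ≤ chainWeight z N σ := by
      rw [chainWeight, Pi.add_apply, Finset.sum_apply]
      exact add_nonneg (Finset.sum_nonneg hw) (by positivity)
    by_cases hσ : ∃ i < m, σ (z i) = 0
    · obtain ⟨i, him, hi⟩ := hσ
      have h1 : (1 / 2 : ℝ) ^ i ≤ chainWeight z N σ := by
        rw [chainWeight, Pi.add_apply, Finset.sum_apply]
        have h2 := Finset.single_le_sum hw (Finset.mem_range.2 (him.trans_le hmN))
        have h3 : (((1 / 2 : ℝ) ^ i) • zeroAt (z i)) σ = (1 / 2 : ℝ) ^ i := by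
          simp [zeroAt, hi]
        rw [h3] at h2
        exact h2.trans (le_add_of_nonneg_right (by positivity))
      have h4 : (1 / 2 : ℝ) ^ m ≤ (1 / 2 : ℝ) ^ i :=
        pow_le_pow_of_le_one (by norm_num) (by norm_num) him.le
      have h5 : (2 : ℝ) ^ m * (1 / 2 : ℝ) ^ m = 1 := by
        rw [← mul_pow]
        norm_num
      have h6 : (2 : ℝ) ^ m * (1 / 2 : ℝ) ^ m ≤ 2 ^ m * chainWeight z N σ :=
        mul_le_mul_of_nonneg_left (h4.trans h1) (by positivity)
      have h7 := hf0 σ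
      simp only [Pi.sub_apply, Pi.smul_apply, smul_eq_mul, Pi.zero_apply] at h7 ⊢
      linarith
    · push Not at hσ
      have h1 : f σ = 1 := by
        refine Finset.prod_eq_one fun x _ => ?_
        simp only [g]
        split_ifs with hx
        · obtain ⟨i, hi, rfl⟩ := Finset.mem_image.1 hx
          have h2 : σ (z i) = 1 := Fin.eq_one_of_ne_zero _ (hσ i (Finset.mem_range.1 hi))
          simp [h2]
        · rfl
      rw [Pi.sub_apply, h1, sub_self]
      exact mul_nonneg (by positivity) hw0
  have h1 := semigroup_mono (C := C) hp0 hp1 ht hle fun _ => 1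
  have h2 := semigroup_le_of_generator_le hp0 hp1 (generator_chainWeight_le hp0 hN hz) ht
    fun _ => 1
  have h3 : chainWeight z N (fun _ => 1) = (1 / 2 : ℝ) ^ N := by
    simp [chainWeight, zeroAt]
  have h4 := (mean_sub_semigroup_le_tvDist (p := p) (C := C) t (fun _ => 1)
    (f := (fun _ => 1) - f) (fun σ => sub_nonneg.2 (hf1 σ))
    (fun σ => sub_le_self _ (hf0 σ))).trans (h _ (single_mem_stdSimplex ℝ _))
  rw [mean_sub, mean_const, hmean] at h4
  rw [map_smul] at h1
  simp only [Pi.smul_apply, smul_eq_mul, h3] at h1 h2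
  have h5 : (2 : ℝ) ^ m * semigroup p C t (chainWeight z N) (fun _ => 1)
      ≤ 2 ^ m * (Real.exp (2 * t) * (1 / 2) ^ N) := mul_le_mul_of_nonneg_left h2 (by positivity)
  have h6 : (1 / 2 : ℝ) ≤ 2 ^ m * (Real.exp (2 * t) * (1 / 2) ^ N) := by linarith
  have h7 := mul_le_mul_of_nonneg_left h6 (by positivity : (0 : ℝ) ≤ 2 * 2 ^ N)
  have h8 : (2 : ℝ) ^ N * (1 / 2 : ℝ) ^ N = 1 := by
    rw [← mul_pow]
    norm_num
  calc (2 : ℝ) ^ N = 2 * 2 ^ N * (1 / 2) := by ring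
    _ ≤ 2 * 2 ^ N * (2 ^ m * (Real.exp (2 * t) * (1 / 2) ^ N)) := h7
    _ = 2 ^ (m + 1) * Real.exp (2 * t) * (2 ^ N * (1 / 2) ^ N) := by ring
    _ = 2 ^ (m + 1) * Real.exp (2 * t) := by rw [h8, mul_one]

theorem IsConstraining.exists_chain (hC : IsConstraining C) (hd : 1 ≤ d) (hn : 1 ≤ n) :
    ∃ z : ℕ → Site d n, (∀ i, i + 1 < n → z (i + 1) ∈ C (z i)) ∧
      Set.InjOn z (Finset.range n) := by
  classical
  let parent : Site d n → Site d n := fun x => if h : (C x).Nonempty then h.choose else x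
  have hparent : ∀ x, (C x).Nonempty → parent x ∈ C x := fun x h => by
    simp only [parent, dif_pos h]
    exact h.choose_spec
  let corner : Site d n := ⟨fun _ => n, by
    rw [Fintype.mem_piFinset]
    exact fun _ => Finset.mem_Icc.2 ⟨by exact_mod_cast hn, le_rfl⟩⟩
  let z : ℕ → Site d n := fun i => parent^[i] corner
  have hzs : ∀ i, z (i + 1) = parent (z i) := fun i => Function.iterate_succ_apply' _ _ _
  let e : Fin d := ⟨0, hd⟩
  -- One step lowers a coordinate by at most `1`, so `(1,…,1)` is not reached while `i + 1 < n` and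
  -- the neighbourhood there is nonempty.
  have hcoord : ∀ i : ℕ, (n : ℤ) - i ≤ (z i).1 e := by
    intro i
    induction i with
    | zero => simp [z, corner]
    | succ i ih =>
      rw [hzs]
      push_cast
      by_cases h : (C (z i)).Nonempty
      · rcases (hC.coord_sub (hparent _ h)).1 e with h' | h' <;> linarith
      · have : parent (z i) = z i := dif_neg h
        rw [this]
        linarith
  have hmem : ∀ i, i + 1 < n → z (i + 1) ∈ C (z i) := by
    intro i hi
    rw [hzs]
    refine hparent _ ((hC (z i)).2 fun h1 => ?_).1
    have h2 := hcoord i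
    rw [h1, Pi.one_apply] at h2
    omega
  have hlt : ∀ i j, i < j → j < n → siteRank (z j) < siteRank (z i) := by
    intro i j hij
    induction j, hij using Nat.le_induction with
    | base => exact fun hj => hC.siteRank_lt _ _ (hmem i hj)
    | succ j hij ih =>
      exact fun hj => (hC.siteRank_lt _ _ (hmem j hj)).trans (ih (by omega))
  refine ⟨z, hmem, fun i hi j hj hij => ?_⟩
  have hi' : i < n := by simpa using hi
  have hj' : j < n := by simpa using hj
  rcases lt_trichotomy i j with h | h | h
  · exact absurd (hlt i j h hj') (by rw [hij]; exact lt_irrefl _)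
  · exact h
  · exact absurd (hlt j i h hi') (by rw [hij]; exact lt_irrefl _)

theorem IsConstraining.mul_le_of_tvDist_le (hC : IsConstraining C) (hp0 : 0 < p) (hp1 : p < 1)
    (hd : 1 ≤ d) (hn : 1 ≤ n) {m : ℕ} (hpm : p ^ m ≤ 1 / 4) {t : ℝ} (ht : 0 ≤ t)
    (h : ∀ ν ∈ stdSimplex ℝ (Config d n),
      tvDist (lawAt p C ν t) (productMeasure p) ≤ 1 / 4) :
    Real.log 2 / (4 * (m + 1)) * n ≤ t := by
  have hlog : 0 < Real.log 2 := Real.log_pos one_lt_two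
  have hm : (0 : ℝ) < m + 1 := by positivity
  -- For short cubes the free corner spin gives `log 2 ≤ t`; otherwise `m + 1 ≤ n / 4` is negligible
  -- against the chain length `n`.
  rcases le_total n (4 * (m + 1)) with hnm | hnm
  · let x : Site d n := ⟨1, by
      rw [Fintype.mem_piFinset]
      exact fun _ => Finset.mem_Icc.2 ⟨le_rfl, by rw [Pi.one_apply]; exact_mod_cast hn⟩⟩
    refine le_trans ?_ (log_two_le_of_tvDist_le hp0 hp1 ((hC x).1 rfl) ht h)
    have h1 : (n : ℝ) ≤ 4 * (m + 1) := by exact_mod_cast hnm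
    rw [div_mul_eq_mul_div, div_le_iff₀ (by positivity)]
    exact mul_le_mul_of_nonneg_left h1 hlog.le
  · obtain ⟨z, hz, hinj⟩ := hC.exists_chain hd hn
    have h1 := le_exp_of_tvDist_le hp0 hp1 hn (by omega : m ≤ n) hpm hz
      (hinj.mono (by simpa using (by omega : m ≤ n))) ht h
    have h2 := Real.log_le_log (by positivity) h1
    rw [Real.log_mul (by positivity) (Real.exp_pos _).ne', Real.log_pow, Real.log_pow,
      Real.log_exp] at h2
    push_cast at h2
    have h3 : 4 * ((m : ℝ) + 1) ≤ n := by exact_mod_cast hnm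
    have h4 : Real.log 2 * (4 * ((m : ℝ) + 1)) ≤ Real.log 2 * n :=
      mul_le_mul_of_nonneg_left h3 hlog.le
    have h5 : Real.log 2 / (4 * (m + 1)) * n ≤ Real.log 2 / 4 * n := by
      refine mul_le_mul_of_nonneg_right ?_ (Nat.cast_nonneg n)
      exact div_le_div_of_nonneg_left hlog.le (by norm_num) (by linarith [m.cast_nonneg (α := ℝ)])
    linarith

end LowerBound

end OrientedKCM

end

/-! ### Choice of the constants. -/

theorem theorem1 (d : ℕ) (hd : 1 ≤ d) (p : ℝ) (hp0 : 0 < p) (hp1 : p < 1)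
    (C : (n : ℕ) → OrientedKCM.Site d n → Finset (OrientedKCM.Site d n))
    (hC : ∀ n : ℕ, 1 ≤ n → OrientedKCM.IsConstraining (C n))
    (hgap : ∃ lam : ℝ, 0 < lam ∧ ∀ n : ℕ, 1 ≤ n → lam ≤ OrientedKCM.spectralGap p (C n)) :
    ∃ A B : ℝ, 0 < A ∧ 0 < B ∧
      (∀ n : ℕ, 1 ≤ n → A * (n : ℝ) ≤ OrientedKCM.mixingTime p (C n)) ∧
      (∀ n : ℕ, 2 ≤ n →
        OrientedKCM.mixingTime p (C n) ≤ B * ((n : ℝ) * Real.log (n : ℝ))) := by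
  obtain ⟨lam, hlam, hgap⟩ := hgap
  obtain ⟨m, hm⟩ := exists_pow_lt_of_lt_one (by norm_num : (0 : ℝ) < 1 / 4) hp1
  set μ := OrientedKCM.relaxationRate lam ((1 - p) ^ 2 ^ d)
  have hμ : 0 < μ := OrientedKCM.relaxationRate_pos hlam (pow_pos (sub_pos.2 hp1) _)
  have hmixed : ∀ n : ℕ, 1 ≤ n → ∀ s : ℝ, 0 < s → (n : ℝ) ^ d * Real.exp (-(μ * s)) ≤ 1 / 4 →
      0 < ((d * n + 1 : ℕ) : ℝ) * s ∧
        ∀ ν ∈ stdSimplex ℝ (OrientedKCM.Config d n),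
          OrientedKCM.tvDist (OrientedKCM.lawAt p (C n) ν ((d * n + 1 : ℕ) * s))
            (OrientedKCM.productMeasure p) ≤ 1 / 4 := fun n hn s hs h =>
    ⟨by positivity, fun ν hν => (OrientedKCM.tvDist_lawAt_le hp0 hp1 (hC n hn) hlam (hgap n hn)
      hs.le hν).trans h⟩
  -- With this `s` the bound is `n ^ d * n ^ (-(d + 2)) = n ^ (-2)`, at most `1 / 4` because `n ≥
  -- 2`.
  have hexp : ∀ n : ℕ, 2 ≤ n → (n : ℝ) ^ d * Real.exp (-(μ * ((d + 2) / μ * Real.log n)))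
      ≤ 1 / 4 := by
    intro n hn
    have hn0 : (0 : ℝ) < n := by positivity
    have h2 : (2 : ℝ) ≤ n := by exact_mod_cast hn
    have e : -(μ * ((d + 2) / μ * Real.log n)) = -(((d + 2 : ℕ) : ℝ) * Real.log n) := by
      push_cast
      field_simp
    rw [e, Real.exp_neg, Real.exp_nat_mul, Real.exp_log hn0, pow_add, mul_inv, ← mul_assoc,
      mul_inv_cancel₀ (by positivity), one_mul, one_div]
    exact inv_anti₀ (by norm_num) (by nlinarith)
  -- The lower bound needs the set of mixing times to be nonempty, since `sInf ∅ = 0`. At `n = 1`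
  -- the choice above gives `s = 0`, hence a different `s`.
  have hne : ∀ n : ℕ, 1 ≤ n → ∃ s : ℝ, 0 < s ∧ (n : ℝ) ^ d * Real.exp (-(μ * s)) ≤ 1 / 4 := by
    intro n hn
    have h4 : (1 : ℝ) < 4 * n ^ d := by
      have : (1 : ℝ) ≤ n ^ d := one_le_pow₀ (by exact_mod_cast hn)
      linarith
    have hn0 : (0 : ℝ) < n := by positivity
    refine ⟨Real.log (4 * n ^ d) / μ, div_pos (Real.log_pos h4) hμ, ?_⟩
    rw [mul_div_cancel₀ _ hμ.ne', Real.exp_neg, Real.exp_log (by positivity)]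
    refine le_of_eq ?_
    field_simp
  refine ⟨Real.log 2 / (4 * (m + 1)), (d + 1) * ((d + 2) / μ),
    div_pos (Real.log_pos one_lt_two) (by positivity), by positivity, fun n hn => ?_,
    fun n hn => ?_⟩
  · obtain ⟨s, hs0, hs⟩ := hne n hn
    exact le_csInf ⟨_, hmixed n hn s hs0 hs⟩ fun t ht =>
      (hC n hn).mul_le_of_tvDist_le hp0 hp1 hd hn hm.le ht.1.le ht.2
  · have hlog : 0 < Real.log n := Real.log_pos (by exact_mod_cast hn)
    have hs0 : 0 < (d + 2) / μ * Real.log n := by positivity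
    refine (csInf_le ⟨(0 : ℝ), fun _ ht => ht.1.le⟩
      (hmixed n (by omega) _ hs0 (hexp n hn))).trans ?_
    have h1 : ((d * n + 1 : ℕ) : ℝ) ≤ (d + 1) * n := by
      have : (1 : ℝ) ≤ n := by exact_mod_cast (by omega : 1 ≤ n)
      push_cast
      linarith
    calc ((d * n + 1 : ℕ) : ℝ) * ((d + 2) / μ * Real.log n)
        ≤ (d + 1) * n * ((d + 2) / μ * Real.log n) := mul_le_mul_of_nonneg_right h1 hs0.le
      _ = (d + 1) * ((d + 2) / μ) * (n * Real.log n) := by ring
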